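/- Let $n\ge 1$ be an integer, $N=2^n$, $h_1=\frac{1}{2^n+1}$ and $p\in\mathbb{R}$. Let $A_{n,1}$ be the $N\times N$ tridiagonal matrix with $-2$ on the diagonal and $1$ on the first sub- and superdiagonal (that is, $h_1^2$ times the finite-difference Dirichlet Laplacian on the interior grid points of $(0,1)$), and let $D_n$ be $\frac{1}{2h_1}$ times the tridiagonal matrix with $0$ on the diagonal, $1$ on the superdiagonal and $-1$ on the subdiagonal (the central-difference first derivative). Let $S_n$ be the $N\times N$ increment matrix, $S_n e_j=e_{j+1 \bmod N}$ for $0\le j<N$; let $C_n^-$ be the $N\times N$ matrix that vanishes off the anti-diagonal, whose anti-diagonal entries are $1$ in the two corners and $-1$ elsewhere; and let $I$, $X$, $Z$ be the one-qubit identity and Pauli matrices. Then $$A_{n,1}+p h_1^2 D_n=-2I^{\otimes n}+\tfrac{2-ph_1}{2}S_n+\tfrac{2+ph_1}{2}S_n^\dagger-\tfrac12X^{\otimes n}-\tfrac12C_n^-+\tfrac{h_1p}{4}\left(I^{\otimes n-1}\otimes Z\right)X^{\otimes n}+\tfrac{h_1p}{4}\left(I^{\otimes n-1}\otimes Z\right)C_n^-,$$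 and the seven matrices $R_{4,1},\dots,R_{4,7}$ (in the order displayed) whose real linear combination stands on the right-hand side are unitary. Moreover, there is an absolute constant $K$ such that, for every $n\ge1$, each $R_{4,l}$ is implemented exactly, with one ancilla qubit, by a circuit consisting of at most one $Z$ gate, at most two Hadamard gates and at most $Kn$ Toffoli, $X$ and $CNOT$ gates in total, and no other gates; that is, the matrix of the circuit on the $n+1$ qubits, the last of which is the ancilla, is $R_{4,l}\otimes I$ (so the ancilla may be in any state and is returned unchanged). -/

import Mathlib

open scoped Matrix Kronecker

namespace LCU

noncomputable section

/-! ### Qubits, tensor products and gates -/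

/-- Square matrices of size `2 ^ n` over `ℂ`: operators on `n` qubits. -/
abbrev Op (n : ℕ) : Type := Matrix (Fin (2 ^ n)) (Fin (2 ^ n)) ℂ

/-- Basis states of `n` qubits (qubits are numbered from `0` to `n - 1`) as row and column indices
of `2 ^ n × 2 ^ n` matrices. Qubit `0`, the leftmost tensor factor, is the most significant binary
digit of the index; see `binIdx_val`. -/
def binIdx (n : ℕ) : (Fin n → Fin 2) ≃ Fin (2 ^ n) :=
  (Equiv.arrowCongr Fin.revPerm (Equiv.refl (Fin 2))).trans finFunctionFinEquiv

theorem binIdx_val (n : ℕ) (x : Fin n → Fin 2) :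
    (binIdx n x : ℕ) = ∑ q : Fin n, (x q : ℕ) * 2 ^ (n - 1 - (q : ℕ)) := by
  have h : (binIdx n x : ℕ) = ∑ q : Fin n, (x (Fin.rev q) : ℕ) * 2 ^ (q : ℕ) := by
    simp [binIdx]
  rw [h, ← Equiv.sum_comp Fin.revPerm]
  refine Finset.sum_congr rfl fun q _ => ?_
  simp only [Fin.revPerm_apply, Fin.rev_rev, Fin.val_rev]
  congr 2
  omega

/-- The `2 ^ n × 2 ^ n` matrix of an operator given by its entries between basis states. -/
def ofBasis {n : ℕ} (M : Matrix (Fin n → Fin 2) (Fin n → Fin 2) ℂ) : Op n :=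
  Matrix.reindex (binIdx n) (binIdx n) M

/-- The tensor (Kronecker) product `M 0 ⊗ M 1 ⊗ ⋯ ⊗ M (n - 1)` of one-qubit operators. -/
def tensor {n : ℕ} (M : Fin n → Matrix (Fin 2) (Fin 2) ℂ) : Op n :=
  ofBasis (Matrix.of fun x y => ∏ q, M q (x q) (y q))

/-- The Pauli `X` (or `NOT`) gate. -/
def pauliX : Matrix (Fin 2) (Fin 2) ℂ := !![0, 1; 1, 0]

/-- The Pauli `Z` gate. -/
def pauliZ : Matrix (Fin 2) (Fin 2) ℂ := !![1, 0; 0, -1]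

/-- The Hadamard gate. -/
def hadamard : Matrix (Fin 2) (Fin 2) ℂ :=
  ((1 / Real.sqrt 2 : ℝ) : ℂ) • !![1, 1; 1, -1]

/-- The one-qubit gate `G` applied to qubit `t`, the identity on all other qubits. -/
def onQubit {k : ℕ} (t : Fin k) (G : Matrix (Fin 2) (Fin 2) ℂ) : Op k :=
  tensor (Function.update (fun _ => 1) t G)

/-- The multi-control `NOT` with control set `C` and target `t`: it adds `1` modulo `2` to qubit `t`
of a basis state if all qubits in `C` are `1`, and fixes the basis state otherwise. -/
def ctrlNot {k : ℕ} (C : Finset (Fin k)) (t : Fin k) : Op k :=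
  ofBasis (Matrix.of fun y x =>
    if y = (if ∀ c ∈ C, x c = 1 then Function.update x t (x t + 1) else x) then 1 else 0)

/-- The elementary gates, on a register of `k` qubits. -/
inductive Gate (k : ℕ) : Type
  | X (t : Fin k) : Gate k
  | Z (t : Fin k) : Gate k
  | H (t : Fin k) : Gate k
  | CNOT (c t : Fin k) (hct : c ≠ t) : Gate k
  | Toffoli (c₁ c₂ t : Fin k) (h₁₂ : c₁ ≠ c₂) (h₁ : c₁ ≠ t) (h₂ : c₂ ≠ t) : Gate k

/-- The matrix of an elementary gate. -/
def Gate.op {k : ℕ} : Gate k → Op k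
  | .X t => onQubit t pauliX
  | .Z t => onQubit t pauliZ
  | .H t => onQubit t hadamard
  | .CNOT c t _ => ctrlNot {c} t
  | .Toffoli c₁ c₂ t _ _ _ => ctrlNot {c₁, c₂} t

/-- `g` is a `Z` gate. -/
def Gate.isZ {k : ℕ} : Gate k → Bool
  | .Z _ => true
  | _ => false

/-- `g` is a Hadamard gate. -/
def Gate.isH {k : ℕ} : Gate k → Bool
  | .H _ => true
  | _ => false

/-- `g` is a Toffoli, `X` or `CNOT` gate. -/
def Gate.isClassical {k : ℕ} : Gate k → Bool
  | .X _ => true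
  | .CNOT _ _ _ => true
  | .Toffoli _ _ _ _ _ _ => true
  | _ => false

/-- A circuit on `k` qubits: the list of its gates, in the order in which they are applied. -/
abbrev Circuit (k : ℕ) : Type := List (Gate k)

/-- The matrix of a circuit. -/
def Circuit.op {k : ℕ} : Circuit k → Op k
  | [] => 1
  | g :: gs => Circuit.op gs * g.op

/-- `U ⊗ I`: the operator `U` on qubits `0, …, n - 1` and the identity on the last qubit `n`. -/
def withAncilla {n : ℕ} (U : Op n) : Op (n + 1) :=
  Matrix.reindex (finProdFinEquiv.trans (finCongr (pow_succ 2 n).symm))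
    (finProdFinEquiv.trans (finCongr (pow_succ 2 n).symm)) (U ⊗ₖ (1 : Matrix (Fin 2) (Fin 2) ℂ))

/-- The circuit implements `U` with the help of a single ancilla, the last qubit: whatever the state
of the ancilla is, it is given back unchanged, and `U` is applied to the other `n` qubits. -/
def Implements {n : ℕ} (Q : Circuit (n + 1)) (U : Op n) : Prop :=
  Q.op = withAncilla U

/-! ### The discretized operators and the terms of the decomposition -/

/-- The mesh size `1 / (2 ^ n + 1)`. -/
def meshSize (n : ℕ) : ℝ := 1 / (2 ^ n + 1)

/-- The finite-difference Dirichlet Laplacian on the interior grid points of `(0, 1)`: the matrix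
`tridiag (1, -2, 1)`, divided by the square of the mesh size. -/
def dirichletLaplacian (n : ℕ) : Op n :=
  (1 / meshSize n ^ 2) • (Matrix.of fun i j =>
    if i = j then -2
    else if (i : ℕ) + 1 = (j : ℕ) ∨ (j : ℕ) + 1 = (i : ℕ) then 1 else 0 : Op n)

/-- The normalized Dirichlet Laplacian. -/
def normLaplacian (n : ℕ) : Op n := meshSize n ^ 2 • dirichletLaplacian n

/-- The central-difference first derivative: the matrix `tridiag (-1, 0, 1)`, divided by twice the
mesh size. -/
def centralDiff (n : ℕ) : Op n :=
  (1 / (2 * meshSize n)) • (Matrix.of fun i j =>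
    if (i : ℕ) + 1 = (j : ℕ) then 1 else if (j : ℕ) + 1 = (i : ℕ) then -1 else 0 : Op n)

/-- The increment gate: the basis state with index `j` is sent to the one with index `j + 1`, modulo
`2 ^ n`. -/
def increment (n : ℕ) : Op n :=
  Matrix.of fun i j => if (i : ℕ) = ((j : ℕ) + 1) % 2 ^ n then 1 else 0

/-- The anti-diagonal matrix whose two corner entries on the anti-diagonal are `1` and whose other
entries on the anti-diagonal are `-1`. -/
def antiDiagMinus (n : ℕ) : Op n :=
  Matrix.of fun i j =>
    if (i : ℕ) + (j : ℕ) + 1 = 2 ^ n then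
      (if (i : ℕ) = 0 ∨ (j : ℕ) = 0 then 1 else -1)
    else 0

/-- `X ⊗ X ⊗ ⋯ ⊗ X`. -/
def tensorX (n : ℕ) : Op n := tensor fun _ => pauliX

/-- `I ⊗ ⋯ ⊗ I ⊗ Z`. -/
def lastZ (n : ℕ) : Op n := tensor fun q => if (q : ℕ) + 1 = n then pauliZ else 1

/-- The seven unitaries of the decomposition. -/
def lcuTerm (n : ℕ) : Fin 7 → Op n :=
  ![1,
    increment n,
    (increment n)ᴴ,
    tensorX n,
    antiDiagMinus n,
    lastZ n * tensorX n,
    lastZ n * antiDiagMinus n]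

/-- The seven real coefficients of the decomposition. -/
def lcuCoeff (n : ℕ) (p : ℝ) : Fin 7 → ℝ :=
  ![-2,
    (2 - p * meshSize n) / 2,
    (2 + p * meshSize n) / 2,
    -(1 / 2),
    -(1 / 2),
    meshSize n * p / 4,
    meshSize n * p / 4]

end

end LCU

/-! The decomposition is a correction at two corners. The increment matrix is the subdiagonal shift
plus a `1` in the corner (0, N-1), and its adjoint is the superdiagonal shift plus a `1` in the
opposite corner. In `tensorX + antiDiagMinus` everything on the anti-diagonal cancels except the two
corners, which become 2. This removes the symmetric part of the unwanted corners. Since N is even,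
rows 0 and N-1 have opposite parity, so multiplying by `lastZ` gives the two corners opposite signs
and removes the part proportional to `p` (`decomposition`).

For the circuits, every term is a signed permutation of basis states (`signedMap`), so classical
gates are studied through their action on bit strings. Addition in `Fin 2` is XOR and multiplication
is AND. All auxiliary wires are borrowed: their state is arbitrary and must be restored.

The increment rests on a ripple-carry adder (`exists_adder`). Subtracting an unknown number and
adding it back with one bit changed leaves a net change of one bit (`exists_adds_bit`), so a
register can be incremented with as many borrowed wires. With only one spare wire, the register is
cut into halves that lend wires to each other (`exists_adds_one`). Negation of all bits turns adding
into subtracting and gives the adjoint.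

The terms with `antiDiagMinus` negate all bits with a sign depending on whether all bits agree.
Comparing the wires with the last one turns this condition into a conjunction, and Hadamard gates
around a multi-controlled `NOT` turn the conjunction into a sign (`hadamard_conj_toggle`,
`Realizes.allOnes`).

Unitarity needs no separate computation: elementary gates are unitary, hence so is whatever a
circuit implements (`Implements.mem_unitaryGroup`). -/

namespace LCU

variable {k : ℕ}

/-! ### Classical reversible circuits -/

/-- Labels of the computational basis of `k` qubits. -/
abbrev BasisState (k : ℕ) : Type := Fin k → Fin 2

/-- Add the bit `b s` to the wire `t`. -/
def toggle (t : Fin k) (b : BasisState k → Fin 2) (s : BasisState k) : BasisState k :=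
  Function.update s t (s t + b s)

theorem toggle_same (t : Fin k) (b : BasisState k → Fin 2) (s : BasisState k) :
    toggle t b s t = s t + b s := by simp [toggle]

theorem toggle_of_ne {t w : Fin k} (h : w ≠ t) (b : BasisState k → Fin 2) (s : BasisState k) :
    toggle t b s w = s w := by simp [toggle, h]

/-- The action of a `Toffoli`, `X` or `CNOT` gate on basis states; the other gates are ignored. -/
def Gate.act : Gate k → BasisState k → BasisState k
  | .X t => toggle t fun _ => 1
  | .CNOT c t _ => toggle t fun s => s c
  | .Toffoli c₁ c₂ t _ _ _ => toggle t fun s => s c₁ * s c₂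
  | _ => id

/-- The action of the classical gates of a circuit on basis states. -/
def Circuit.run : Circuit k → BasisState k → BasisState k
  | [] => id
  | g :: gs => Circuit.run gs ∘ g.act

theorem Circuit.run_append (P Q : Circuit k) :
    Circuit.run (P ++ Q) = Circuit.run Q ∘ Circuit.run P := by
  induction P with
  | nil => rfl
  | cons g gs ih => simp only [List.cons_append, Circuit.run, ih, Function.comp_assoc]

/-- `f` is computed by at most `m` classical gates. -/
def Realizes (f : BasisState k → BasisState k) (m : ℕ) : Prop :=
  ∃ Q : Circuit k, (∀ g ∈ Q, g.isClassical = true) ∧ Q.length ≤ m ∧ Circuit.run Q = f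

theorem Realizes.id : Realizes (id : BasisState k → BasisState k) 0 :=
  ⟨[], by simp, by simp, rfl⟩

theorem Realizes.mono {f : BasisState k → BasisState k} {m m' : ℕ} (h : Realizes f m)
    (hm : m ≤ m') : Realizes f m' := by
  obtain ⟨Q, h1, h2, h3⟩ := h
  exact ⟨Q, h1, h2.trans hm, h3⟩

theorem Realizes.comp {f g : BasisState k → BasisState k} {m m' : ℕ} (hg : Realizes g m')
    (hf : Realizes f m) : Realizes (g ∘ f) (m + m') := by
  obtain ⟨P, p1, p2, p3⟩ := hf
  obtain ⟨Q, q1, q2, q3⟩ := hg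
  refine ⟨P ++ Q, ?_, ?_, ?_⟩
  · intro g hg
    rcases List.mem_append.1 hg with h | h
    exacts [p1 g h, q1 g h]
  · rw [List.length_append]; omega
  · rw [Circuit.run_append, p3, q3]

theorem Realizes.of_gate (g : Gate k) (hg : g.isClassical = true) : Realizes g.act 1 :=
  ⟨[g], by simpa using hg, by simp, rfl⟩

theorem Realizes.not (t : Fin k) : Realizes (toggle t fun _ => 1) 1 :=
  .of_gate (.X t) rfl

theorem Realizes.cnot {c t : Fin k} (h : c ≠ t) : Realizes (toggle t fun s => s c) 1 :=
  .of_gate (.CNOT c t h) rfl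

theorem Realizes.toffoli {c₁ c₂ t : Fin k} (h : c₁ ≠ c₂) (h₁ : c₁ ≠ t) (h₂ : c₂ ≠ t) :
    Realizes (toggle t fun s => s c₁ * s c₂) 1 :=
  .of_gate (.Toffoli c₁ c₂ t h h₁ h₂) rfl

/-- Add the bit `b s` to all wires in `R`. -/
def flipAll (R : List (Fin k)) (b : BasisState k → Fin 2) (s : BasisState k) : BasisState k :=
  fun w => if w ∈ R then s w + b s else s w

theorem flipAll_of_mem {R : List (Fin k)} {w : Fin k} (h : w ∈ R) (b : BasisState k → Fin 2)
    (s : BasisState k) : flipAll R b s w = s w + b s := by simp [flipAll, h]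

theorem flipAll_of_notMem {R : List (Fin k)} {w : Fin k} (h : w ∉ R) (b : BasisState k → Fin 2)
    (s : BasisState k) : flipAll R b s w = s w := by simp [flipAll, h]

/-- The wires can be toggled one at a time because `b` does not read `R`, so earlier toggles leave
its value unchanged. -/
theorem Realizes.flipAll {R : List (Fin k)} (hR : R.Nodup) {b : BasisState k → Fin 2}
    (hb : ∀ s s' : BasisState k, (∀ w ∉ R, s w = s' w) → b s = b s')
    (h : ∀ t ∈ R, Realizes (toggle t b) 1) : Realizes (flipAll R b) R.length := by
  suffices H : ∀ W : List (Fin k), W.Nodup → W ⊆ R → Realizes (LCU.flipAll W b) W.length from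
    H R hR (List.Subset.refl R)
  intro W
  induction W with
  | nil =>
    intro _ _
    have h0 : LCU.flipAll ([] : List (Fin k)) b = _root_.id := by
      funext s w
      simp [LCU.flipAll]
    rw [h0]
    exact Realizes.id
  | cons x xs ih =>
    intro hn hs
    rw [List.nodup_cons] at hn
    have h1 := (ih hn.2 (fun w hw => hs (List.mem_cons_of_mem _ hw))).comp
      (h x (hs List.mem_cons_self))
    rw [List.length_cons, Nat.add_comm]
    convert h1 using 1
    funext s w
    have hbs : b (toggle x b s) = b s := by
      refine hb _ _ fun w hw => toggle_of_ne ?_ _ _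
      rintro rfl
      exact hw (hs List.mem_cons_self)
    simp only [Function.comp_apply, LCU.flipAll, hbs, List.mem_cons]
    by_cases hwx : w = x
    · subst hwx
      simp [hn.1, toggle_same]
    · simp [hwx, toggle_of_ne hwx]

theorem Realizes.flipAll_one {R : List (Fin k)} (hR : R.Nodup) :
    Realizes (LCU.flipAll R fun _ => 1) R.length :=
  .flipAll hR (fun _ _ _ => rfl) fun t _ => .not t

theorem Realizes.flipAll_wire {R : List (Fin k)} (hR : R.Nodup) {c : Fin k} (hc : c ∉ R) :
    Realizes (LCU.flipAll R fun s => s c) R.length :=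
  .flipAll hR (fun _ _ h => h c hc) fun _ ht => .cnot fun h => hc (h ▸ ht)

theorem modEq_of_eq {m a b : ℤ} (h : a = b) : a ≡ b [ZMOD m] := h ▸ Int.ModEq.refl a

/-! ### Registers and modular addition -/

/-- The number stored in a register, least significant bit first. -/
def val (s : BasisState k) : List (Fin k) → ℤ
  | [] => 0
  | w :: ws => ((s w : ℕ) : ℤ) + 2 * val s ws

theorem val_congr {s s' : BasisState k} {R : List (Fin k)} (h : ∀ w ∈ R, s w = s' w) :
    val s R = val s' R := by
  induction R with
  | nil => rfl
  | cons w ws ih =>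
    rw [val, val, h w List.mem_cons_self, ih fun w hw => h w (List.mem_cons_of_mem _ hw)]

theorem val_append (s : BasisState k) (L H : List (Fin k)) :
    val s (L ++ H) = val s L + 2 ^ L.length * val s H := by
  induction L with
  | nil => simp [val]
  | cons w ws ih => rw [List.cons_append, val, val, ih, List.length_cons, pow_succ]; ring

theorem val_nonneg (s : BasisState k) (R : List (Fin k)) : 0 ≤ val s R := by
  induction R with
  | nil => simp [val]
  | cons w ws ih => rw [val]; positivity

theorem val_lt (s : BasisState k) (R : List (Fin k)) : val s R < 2 ^ R.length := by
  induction R with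
  | nil => simp [val]
  | cons w ws ih =>
    rw [val, List.length_cons, pow_succ]
    have := (s w).isLt
    omega

theorem val_flip {s s' : BasisState k} {R : List (Fin k)} (h : ∀ w ∈ R, s' w = s w + 1) :
    val s' R = 2 ^ R.length - 1 - val s R := by
  induction R with
  | nil => simp [val]
  | cons w ws ih =>
    rw [val, val, ih fun w hw => h w (List.mem_cons_of_mem _ hw), h w List.mem_cons_self,
      List.length_cons, pow_succ]
    have : ∀ a : Fin 2, ((a + 1 : Fin 2) : ℕ) + (a : ℕ) = 1 := by decide
    have := this (s w)
    omega

/-- The conjunction of the wires in `C`. -/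
def allOnes (C : List (Fin k)) (s : BasisState k) : Fin 2 := if ∀ c ∈ C, s c = 1 then 1 else 0

theorem allOnes_cons (c : Fin k) (C : List (Fin k)) (s : BasisState k) :
    allOnes (c :: C) s = s c * allOnes C s := by
  have h : s c = 0 ∨ s c = 1 := by generalize s c = a; revert a; decide
  rcases h with h | h <;> simp [allOnes, h]

theorem allOnes_append (C C' : List (Fin k)) (s : BasisState k) :
    allOnes (C ++ C') s = allOnes C s * allOnes C' s := by
  induction C with
  | nil => simp [allOnes]
  | cons c C ih =>
    rw [List.cons_append, allOnes_cons, allOnes_cons, ih]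
    generalize s c = a, allOnes C s = b, allOnes C' s = d
    revert a b d; decide

theorem allOnes_congr {s s' : BasisState k} {C : List (Fin k)} (h : ∀ w ∈ C, s w = s' w) :
    allOnes C s = allOnes C s' := by
  have : (∀ c ∈ C, s c = 1) ↔ ∀ c ∈ C, s' c = 1 :=
    ⟨fun H c hc => h c hc ▸ H c hc, fun H c hc => (h c hc).symm ▸ H c hc⟩
  simp [allOnes, this]

theorem val_eq_of_allOnes {s : BasisState k} {R : List (Fin k)} (h : ∀ w ∈ R, s w = 1) :
    val s R = 2 ^ R.length - 1 := by
  induction R with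
  | nil => simp [val]
  | cons w ws ih =>
    rw [val, ih fun w hw => h w (List.mem_cons_of_mem _ hw), h w List.mem_cons_self,
      List.length_cons, pow_succ]
    simp; ring

theorem val_lt_of_not_allOnes {s : BasisState k} {R : List (Fin k)} (h : ¬ ∀ w ∈ R, s w = 1) :
    val s R + 1 < 2 ^ R.length := by
  induction R with
  | nil => simp at h
  | cons w ws ih =>
    rw [val, List.length_cons, pow_succ]
    have h1 := (s w).isLt
    by_cases hw : s w = 1
    · have h2 : ¬ ∀ w ∈ ws, s w = 1 := by
        intro h3
        apply h
        simpa [hw] using h3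
      have := ih h2
      omega
    · have h3 : (s w : ℕ) = 0 := by
        have : (s w : ℕ) ≠ 1 := fun h4 => hw (Fin.ext h4)
        omega
      have := val_lt s ws
      omega

/-! ### Adding to a register: complements, ripple-carry, borrowed wires. -/

/-- `f` adds the number `v s` to the register `R` and touches no other wire. -/
def Adds (R : List (Fin k)) (v : BasisState k → ℤ) (f : BasisState k → BasisState k) : Prop :=
  ∀ s, (∀ w ∉ R, f s w = s w) ∧ val (f s) R ≡ val s R + v s [ZMOD 2 ^ R.length]

/-- Complementing all bits is x ↦ -1 - x modulo the register size, so conjugating x ↦ x + v by it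
gives x ↦ x - v. -/
theorem exists_adds_neg {R : List (Fin k)} (hR : R.Nodup) {v : BasisState k → ℤ}
    (hv : ∀ s s' : BasisState k, (∀ w ∉ R, s w = s' w) → v s = v s')
    {f : BasisState k → BasisState k} {m : ℕ} (hf : Adds R v f) (hm : Realizes f m) :
    ∃ g, Adds R (fun s => -v s) g ∧ Realizes g (m + 2 * R.length) := by
  have hc := Realizes.flipAll_one hR
  refine ⟨_, fun s => ?_, ((hc.comp hm).comp hc).mono (by omega)⟩
  simp only [Function.comp_apply]
  set s₁ := flipAll R (fun _ => 1) s with hs₁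
  obtain ⟨h1, h2⟩ := hf s₁
  have e1 : ∀ w ∉ R, s₁ w = s w := fun w hw => flipAll_of_notMem hw _ _
  constructor
  · intro w hw
    rw [flipAll_of_notMem hw, h1 w hw, e1 w hw]
  · rw [val_flip (s := f s₁) (fun w hw => flipAll_of_mem hw _ _)]
    rw [hv s₁ s e1, val_flip (s := s) (s' := s₁) (fun w hw => flipAll_of_mem hw _ _)] at h2
    have h3 := ((Int.ModEq.refl (2 ^ R.length - 1)).sub h2)
    refine h3.trans (modEq_of_eq ?_)
    ring

/-- Subtract v + c, XOR `b` into `c`, add v + (c ⊕ b), and restore `c`. The unknown `v` cancels and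
(c ⊕ b) - c remains, which is b for c = 0 and -b for c = 1. Complementing `R` before and after when
c = 1 corrects the sign, so the state of the borrowed wire `c` does not matter. -/
theorem exists_adds_bit {R : List (Fin k)} (hR : R.Nodup) {c : Fin k} (hc : c ∉ R)
    {v : BasisState k → ℤ} {b : BasisState k → Fin 2}
    (hv : ∀ s s' : BasisState k, (∀ w, w ∉ R → w ≠ c → s w = s' w) → v s = v s')
    (hb : ∀ s s' : BasisState k, (∀ w, w ∉ R → w ≠ c → s w = s' w) → b s = b s')
    {f : BasisState k → BasisState k} {m m' : ℕ}
    (hf : Adds R (fun s => v s + (s c : ℕ)) f) (hm : Realizes f m)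
    (hm' : Realizes (toggle c b) m') :
    ∃ g, Adds R (fun s => (b s : ℕ)) g ∧ Realizes g (2 * m + 2 * m' + 4 * R.length) := by
  obtain ⟨g, hg, hgm⟩ := exists_adds_neg hR
    (fun s s' h => by rw [hv s s' fun w hw _ => h w hw, h c hc]) hf hm
  have hcc := Realizes.flipAll_wire hR hc
  refine ⟨_, fun s => ?_,
    (hcc.comp (hm'.comp (hm.comp (hm'.comp (hgm.comp hcc))))).mono (by omega)⟩
  simp only [Function.comp_apply]
  set s₁ := flipAll R (fun s => s c) s with hs₁
  obtain ⟨g1, g2⟩ := hg s₁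
  set s₂ := g s₁
  set s₃ := toggle c b s₂ with hs₃
  obtain ⟨f1, f2⟩ := hf s₃
  set s₄ := f s₃
  set s₅ := toggle c b s₄ with hs₅
  have e1 : ∀ w ∉ R, s₁ w = s w := fun w hw => flipAll_of_notMem hw _ _
  have e2 : ∀ w ∉ R, s₂ w = s w := fun w hw => (g1 w hw).trans (e1 w hw)
  have e3 : ∀ w, w ∉ R → w ≠ c → s₃ w = s w := fun w hw hwc =>
    (toggle_of_ne hwc _ _).trans (e2 w hw)
  have e4 : ∀ w, w ∉ R → w ≠ c → s₄ w = s w := fun w hw hwc => (f1 w hw).trans (e3 w hw hwc)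
  have b2 : b s₂ = b s := hb _ _ fun w hw _ => e2 w hw
  have b4 : b s₄ = b s := hb _ _ e4
  have c3 : s₃ c = s c + b s := by rw [hs₃, toggle_same, e2 c hc, b2]
  have c5 : s₅ c = s c := by
    rw [hs₅, toggle_same, f1 c hc, c3, b4]
    generalize s c = x, b s = y
    revert x y; decide
  have hne : ∀ w ∈ R, w ≠ c := fun w hw h => hc (h ▸ hw)
  have v3 : val s₃ R = val s₂ R := val_congr fun w hw => toggle_of_ne (hne w hw) _ _
  have v5 : val s₅ R = val s₄ R := val_congr fun w hw => toggle_of_ne (hne w hw) _ _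
  constructor
  · intro w hw
    rw [flipAll_of_notMem hw]
    by_cases hwc : w = c
    · rw [hwc, c5]
    · rw [hs₅, toggle_of_ne hwc, e4 w hw hwc]
  · beta_reduce at g2 f2
    rw [hv s₁ s fun w hw _ => e1 w hw, e1 c hc] at g2
    rw [hv s₃ s e3, c3, v3] at f2
    have key := f2.trans (g2.add_right _)
    rw [← v5] at key
    have h01 : s c = 0 ∨ s c = 1 := by generalize s c = a; revert a; decide
    rcases h01 with h0 | h0
    · have w1 : val s₁ R = val s R := val_congr fun w hw => by
        rw [hs₁, flipAll_of_mem hw, h0, add_zero]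
      have w6 : val (flipAll R (fun s => s c) s₅) R = val s₅ R := val_congr fun w hw => by
        rw [flipAll_of_mem hw, c5, h0, add_zero]
      rw [w6]
      refine key.trans (modEq_of_eq ?_)
      rw [w1, h0, zero_add]
      simp
    · have w1 : val s₁ R = _ := val_flip (s := s) fun w hw => by
        rw [hs₁, flipAll_of_mem hw, h0]
      have w6 : val (flipAll R (fun s => s c) s₅) R = _ := val_flip (s := s₅) fun w hw => by
        rw [flipAll_of_mem hw, c5, h0]
      rw [w6]
      refine ((Int.ModEq.refl (2 ^ R.length - 1)).sub key).trans (modEq_of_eq ?_)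
      have hbb : ∀ y : Fin 2, (((1 + y : Fin 2) : ℕ) : ℤ) = 1 - ((y : ℕ) : ℤ) := by decide
      rw [w1, h0, hbb, Fin.val_one, Nat.cast_one]
      ring

/-- The ripple-carry adder of Cuccaro, Draper, Kutin and Moulton, with carry-in `c`, summand in
the second wires of `ps`, and target the first wires of `ps` followed by `z`. -/
theorem exists_adder (ps : List (Fin k × Fin k)) (c z : Fin k)
    (hn : (c :: z :: (ps.map Prod.fst ++ ps.map Prod.snd)).Nodup) :
    ∃ f, Adds (ps.map Prod.fst ++ [z]) (fun s => val s (ps.map Prod.snd) + (s c : ℕ)) f ∧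
      Realizes f (6 * ps.length + 1) := by
  induction ps generalizing c with
  | nil =>
    have hcz : c ≠ z := by
      rintro rfl
      simp at hn
    refine ⟨_, fun s => ?_, Realizes.cnot hcz⟩
    constructor
    · intro w hw
      exact toggle_of_ne (by simpa using hw) _ _
    · simp only [List.map_nil, List.nil_append, val, toggle_same, List.length_singleton]
      generalize s c = a, s z = b
      revert a b; decide
  | cons p ps ih =>
    obtain ⟨x, g⟩ := p
    simp only [List.map_cons, List.cons_append, List.nodup_cons, List.mem_cons, List.mem_append,
      List.nodup_append, not_or, List.length_cons] at hn ih ⊢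
    obtain ⟨⟨hcz, hcx, hcX, hcg, hcG⟩, ⟨hzx, hzX, hzg, hzG⟩, ⟨hxX, hxg, hxG⟩, hX, ⟨hgG, hG⟩, hd⟩ := hn
    have hgX : g ∉ ps.map Prod.fst := fun h => hd g h g (Or.inl rfl) rfl
    obtain ⟨f, hf, hm⟩ := ih g ⟨⟨Ne.symm hzg, hgX, hgG⟩, ⟨hzX, hzG⟩, hX, hG,
      fun a ha b hb => hd a ha b (Or.inr hb)⟩
    -- In order of application (right to left): three gates replace `g` by the majority of x, g, c,
    -- which is the next carry; the shorter adder runs with carry-in `g`; two gates undo the changes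
    -- of `g` and `c`; the last one leaves the sum bit in `x`.
    refine ⟨_, fun s => ?_, ((Realizes.cnot hcx).comp <| (Realizes.cnot (Ne.symm hcg)).comp <|
      (Realizes.toffoli hcx hcg hxg).comp <| hm.comp <| (Realizes.toffoli hcx hcg hxg).comp <|
      (Realizes.cnot (Ne.symm hcg)).comp (Realizes.cnot (Ne.symm hxg))).mono (by omega)⟩
    simp only [Function.comp_apply]
    set s₁ := toggle x (fun s => s g) s with hs₁
    set s₂ := toggle c (fun s => s g) s₁ with hs₂
    set s₃ := toggle g (fun s => s c * s x) s₂ with hs₃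
    obtain ⟨f1, f2⟩ := hf s₃
    set s₄ := f s₃
    set s₅ := toggle g (fun s => s c * s x) s₄ with hs₅
    set s₆ := toggle c (fun s => s g) s₅ with hs₆
    set s₇ := toggle x (fun s => s c) s₆ with hs₇
    have r1 : ∀ w, w ≠ x → w ≠ c → w ≠ g → s₃ w = s w := fun w h h' h'' => by
      rw [hs₃, toggle_of_ne h'', hs₂, toggle_of_ne h', hs₁, toggle_of_ne h]
    have r2 : ∀ w, w ≠ x → w ≠ c → w ≠ g → s₇ w = s₄ w := fun w h h' h'' => by
      rw [hs₇, toggle_of_ne h, hs₆, toggle_of_ne h', hs₅, toggle_of_ne h'']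
    have nmem : ∀ {w}, w ∉ ps.map Prod.fst → w ≠ z → w ∉ ps.map Prod.fst ++ [z] := by
      intro w h h'
      simp only [List.mem_append, List.mem_singleton, not_or]
      exact ⟨h, h'⟩
    have c3 : s₃ c = s c + s g := by
      rw [hs₃, toggle_of_ne hcg, hs₂, toggle_same, hs₁, toggle_of_ne hcx,
        toggle_of_ne (Ne.symm hxg)]
    have x3 : s₃ x = s x + s g := by
      rw [hs₃, toggle_of_ne hxg, hs₂, toggle_of_ne (Ne.symm hcx), hs₁, toggle_same]
    have g3 : s₃ g = s g + (s c + s g) * (s x + s g) := by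
      rw [← c3, ← x3, hs₃, toggle_same, toggle_of_ne hcg, toggle_of_ne hxg, hs₂,
        toggle_of_ne (Ne.symm hcg), hs₁, toggle_of_ne (Ne.symm hxg)]
    have c4 := f1 c (nmem hcX hcz)
    have x4 := f1 x (nmem hxX (Ne.symm hzx))
    have g4 := f1 g (nmem hgX (Ne.symm hzg))
    rw [c3] at c4
    rw [x3] at x4
    rw [g3] at g4
    have g5 : s₅ g = s g := by
      rw [hs₅, toggle_same, c4, x4, g4]
      generalize s c = a, s g = b, s x = d
      revert a b d; decide
    have c6 : s₆ c = s c := by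
      rw [hs₆, toggle_same, g5, hs₅, toggle_of_ne hcg, c4]
      generalize s c = a, s g = b
      revert a b; decide
    have x7 : s₇ x = s x + s g + s c := by
      rw [hs₇, toggle_same, c6, hs₆, toggle_of_ne (Ne.symm hcx), hs₅, toggle_of_ne hxg, x4]
    constructor
    · intro w hw
      obtain ⟨hwx, hw⟩ := not_or.1 (mt List.mem_cons.2 hw)
      by_cases hwc : w = c
      · rw [hwc, hs₇, toggle_of_ne hcx, c6]
      by_cases hwg : w = g
      · rw [hwg, hs₇, toggle_of_ne (Ne.symm hxg), hs₆, toggle_of_ne (Ne.symm hcg), g5]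
      rw [r2 w hwx hwc hwg, f1 w hw, r1 w hwx hwc hwg]
    · have hne : ∀ w ∈ ps.map Prod.fst ++ [z], w ≠ x ∧ w ≠ c ∧ w ≠ g := by
        intro w hw
        rcases List.mem_append.1 hw with h | h
        · exact ⟨fun e => hxX (e ▸ h), fun e => hcX (e ▸ h), fun e => hgX (e ▸ h)⟩
        · rw [List.mem_singleton.1 h]
          exact ⟨hzx, Ne.symm hcz, hzg⟩
      have v7 : val s₇ (ps.map Prod.fst ++ [z]) = val s₄ (ps.map Prod.fst ++ [z]) :=
        val_congr fun w hw => r2 w (hne w hw).1 (hne w hw).2.1 (hne w hw).2.2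
      have v3 : val s₃ (ps.map Prod.fst ++ [z]) = val s (ps.map Prod.fst ++ [z]) :=
        val_congr fun w hw => r1 w (hne w hw).1 (hne w hw).2.1 (hne w hw).2.2
      have v3' : val s₃ (ps.map Prod.snd) = val s (ps.map Prod.snd) :=
        val_congr fun w hw => r1 w (fun e => hxG (e ▸ hw)) (fun e => hcG (e ▸ hw))
          (fun e => hgG (e ▸ hw))
      beta_reduce at f2
      rw [v3, v3', g3] at f2
      simp only [val, v7, x7]
      -- The full-adder identity: sum bit plus twice the majority equals the number of ones among
      -- three bits.
      have hm : ∀ a b d : Fin 2, (((a + b + d : Fin 2) : ℕ) : ℤ) +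
          2 * (((b + (d + b) * (a + b) : Fin 2) : ℕ) : ℤ) = (a : ℕ) + (b : ℕ) + (d : ℕ) := by
        decide
      have := hm (s x) (s g) (s c)
      have h2 := (f2.mul_left' (c := 2)).add_left (((s x + s g + s c : Fin 2) : ℕ) : ℤ)
      rw [List.length_cons, pow_succ, mul_comm _ (2 : ℤ)]
      refine h2.trans (modEq_of_eq ?_)
      linear_combination this

/-- Incrementing a register with the help of as many borrowed wires. -/
theorem exists_adds_one_of_borrowed {R D : List (Fin k)} (hn : (R ++ D).Nodup)
    (hl : D.length = R.length) :
    ∃ f, Adds R (fun _ => 1) f ∧ Realizes f (18 * R.length) := by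
  rcases List.eq_nil_or_concat' R with rfl | ⟨xs, z, rfl⟩
  · exact ⟨_, fun s => ⟨fun _ _ => rfl, by simp [val, Int.modEq_one]⟩, Realizes.id⟩
  cases D with
  | nil => simp at hl
  | cons c gs =>
    have hl' : xs.length = gs.length := by simpa using hl.symm
    have h1 : (xs.zip gs).map Prod.fst = xs := List.map_fst_zip hl'.le
    have h2 : (xs.zip gs).map Prod.snd = gs := List.map_snd_zip hl'.ge
    have hz : (xs.zip gs).length = xs.length := by simp [hl']
    have hp : (xs ++ [z] ++ c :: gs).Perm (c :: z :: (xs ++ gs)) := by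
      refine List.perm_middle.trans (List.Perm.cons _ ?_)
      simp
    obtain ⟨f, hf, hm⟩ := exists_adder (xs.zip gs) c z (by rw [h1, h2]; exact hp.nodup_iff.1 hn)
    rw [h1, h2, hz] at *
    have hR : (xs ++ [z]).Nodup := (List.nodup_append.1 hn).1
    have hdis : ∀ w ∈ c :: gs, w ∉ xs ++ [z] := fun w hw hw' =>
      (List.nodup_append.1 hn).2.2 w hw' w hw rfl
    have hcgs : c ∉ gs := (List.nodup_cons.1 (List.nodup_append.1 hn).2.1).1
    -- One borrowed wire serves as carry-in and the others as the unknown summand, one bit shorter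
    -- than `R`; the bit to be added is the constant 1.
    obtain ⟨g, hg, hgm⟩ := exists_adds_bit hR (hdis c List.mem_cons_self) (b := fun _ => 1)
      (fun s s' h => val_congr fun w hw => h w (hdis w (List.mem_cons_of_mem _ hw))
        (fun e => hcgs (e ▸ hw))) (fun _ _ _ => rfl) hf hm (Realizes.not c)
    exact ⟨g, hg, hgm.mono (by simp only [List.length_append, List.length_singleton]; omega)⟩

/-! ### Multi-controlled `NOT` gates -/

/-- The bit that `ladder ps` adds to a wire. -/
def ladderBit : List (Fin k × Fin k) → BasisState k → Fin k → Fin 2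
  | [], _, _ => 0
  | p :: ps, s, w => if w = p.2 then allOnes (p.1 :: ps.map Prod.fst) s else ladderBit ps s w

/-- Add to the second wire of every pair the conjunction of the first wires from this pair on. -/
def ladder (ps : List (Fin k × Fin k)) (s : BasisState k) : BasisState k :=
  fun w => s w + ladderBit ps s w

theorem ladderBit_of_notMem {ps : List (Fin k × Fin k)} {w : Fin k} (h : w ∉ ps.map Prod.snd)
    (s : BasisState k) : ladderBit ps s w = 0 := by
  induction ps with
  | nil => rfl
  | cons p ps ih =>
    simp only [List.map_cons, List.mem_cons, not_or] at h
    rw [ladderBit, if_neg h.1, ih h.2]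

theorem ladderBit_congr {ps : List (Fin k × Fin k)} {s s' : BasisState k}
    (h : ∀ w ∈ ps.map Prod.fst, s w = s' w) (w : Fin k) :
    ladderBit ps s w = ladderBit ps s' w := by
  induction ps with
  | nil => rfl
  | cons p ps ih =>
    rw [ladderBit, ladderBit, ih fun w hw => h w (List.mem_cons_of_mem _ hw),
      show allOnes (p.1 :: ps.map Prod.fst) s = _ from allOnes_congr h]

theorem ladder_of_notMem {ps : List (Fin k × Fin k)} {w : Fin k} (h : w ∉ ps.map Prod.snd)
    (s : BasisState k) : ladder ps s w = s w := by
  rw [ladder, ladderBit_of_notMem h, add_zero]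

theorem add_bit_add_bit (a b : Fin 2) : a + b + b = a := by
  revert a b; decide

theorem Realizes.ladder (ps : List (Fin k × Fin k))
    (hn : (ps.map Prod.fst ++ ps.map Prod.snd).Nodup) :
    Realizes (ladder ps) (2 * ps.length) := by
  induction ps with
  | nil =>
    have h0 : LCU.ladder ([] : List (Fin k × Fin k)) = _root_.id := by
      funext s w
      simp [LCU.ladder, ladderBit]
    rw [h0]
    exact Realizes.id
  | cons p ps ih =>
    simp only [List.map_cons, List.cons_append, List.nodup_cons, List.mem_append, List.mem_cons,
      List.nodup_append, not_or] at hn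
    obtain ⟨⟨h1, h2, h3⟩, hX, ⟨h4, hG⟩, hd⟩ := hn
    have hn' : (ps.map Prod.fst ++ ps.map Prod.snd).Nodup :=
      List.nodup_append.2 ⟨hX, hG, fun a ha b hb => hd a ha b (Or.inr hb)⟩
    have h5 : p.2 ∉ ps.map Prod.fst := fun h => hd _ h _ (Or.inl rfl) rfl
    cases ps with
    | nil =>
      convert (Realizes.cnot h2).mono (show 1 ≤ 2 * [p].length by simp) using 1
      funext s w
      by_cases hw : w = p.2
      · subst hw
        have : ∀ a : Fin 2, (if a = 1 then 1 else 0) = a := by decide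
        simp [LCU.ladder, ladderBit, toggle_same, allOnes, this]
      · simp [LCU.ladder, ladderBit, toggle_of_ne hw, hw]
    | cons q qs =>
      have g1 : p.1 ≠ q.2 := fun e => h3 (by simp [e])
      have g2 : q.2 ≠ p.2 := fun e => h4 (by simp [← e])
      -- Between the two uses of `T` the tail ladder changes `q.2` by its conjunction. The old value
      -- of `q.2` cancels from `p.2`, leaving `p.1` times that conjunction.
      have T := Realizes.toffoli g1 h2 g2
      convert (T.comp ((ih hn').comp T)).mono
        (show _ ≤ 2 * (p :: q :: qs).length by simp only [List.length_cons]; omega) using 1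
      funext s w
      simp only [Function.comp_apply]
      set s₁ := toggle p.2 (fun s => s p.1 * s q.2) s with hs₁
      have e1 : ∀ w, w ≠ p.2 → s₁ w = s w := fun w hw => toggle_of_ne hw _ _
      have e2 : ∀ w, ladderBit (q :: qs) s₁ w = ladderBit (q :: qs) s w :=
        ladderBit_congr fun w hw => e1 w fun e => h5 (e ▸ hw)
      by_cases hw : w = p.2
      · subst hw
        rw [toggle_same, ladder_of_notMem h3, ladder_of_notMem h4, LCU.ladder, LCU.ladder, e2,
          e1 _ g2, e1 _ h2, hs₁, toggle_same, ladderBit, if_pos rfl, ladderBit, if_pos rfl,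
          allOnes_cons, List.map_cons]
        generalize s p.2 = a, allOnes (q.1 :: List.map Prod.fst qs) s = b, s p.1 = c, s q.2 = d
        revert a b c d; decide
      · rw [toggle_of_ne hw, LCU.ladder, LCU.ladder, e2, e1 w hw, ladderBit, if_neg hw]

/-- The multi-controlled `NOT` with the help of borrowed wires. -/
theorem Realizes.allOnes_of_borrowed {C D : List (Fin k)} {t : Fin k}
    (hn : (C ++ t :: D).Nodup) (hl : C.length ≤ D.length + 1) :
    Realizes (toggle t (allOnes C)) (4 * C.length + 1) := by
  cases C with
  | nil =>
    convert (Realizes.not t).mono (show 1 ≤ 4 * ([] : List (Fin k)).length + 1 by simp) using 1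
    funext s
    simp [toggle, LCU.allOnes]
  | cons x xs =>
    have hl' : xs.length ≤ D.length := by simpa using hl
    have h1 : (xs.zip D).map Prod.fst = xs := List.map_fst_zip hl'
    have h2 : ((xs.zip D).map Prod.snd).Sublist D := by
      -- `zip` ignores the wires of `D` beyond the first `xs.length`.
      rw [← List.take_length (l := xs), ← List.take_append_drop xs.length D, List.take_length,
        ← List.append_nil xs, List.zip_append (by simp [hl']), List.append_nil]
      rw [List.zip_nil_left, List.append_nil, List.map_snd_zip (by simp)]
      exact List.sublist_append_left _ _
    have hz : (xs.zip D).length = xs.length := by simp [hl']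
    have hn1 : (((x, t) :: xs.zip D).map Prod.fst ++ ((x, t) :: xs.zip D).map Prod.snd).Nodup := by
      rw [List.map_cons, List.map_cons, h1]
      exact List.Nodup.sublist (List.Sublist.append_left (h2.cons_cons t) _) hn
    have hn2 : ((xs.zip D).map Prod.fst ++ (xs.zip D).map Prod.snd).Nodup := by
      refine List.Nodup.sublist (List.Sublist.append ?_ ?_) hn1
      · exact List.sublist_cons_self _ _
      · exact List.sublist_cons_self _ _
    -- The full ladder adds the wanted conjunction to `t` but also disturbs the borrowed wires; the
    -- ladder without its first pair restores them.
    convert ((Realizes.ladder _ hn2).comp (Realizes.ladder _ hn1)).mono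
      (show _ ≤ 4 * (x :: xs).length + 1 by simp only [List.length_cons, hz]; omega) using 1
    have ht : t ∉ (xs.zip D).map Prod.snd := by
      have := (List.nodup_append.1 hn1).2.1
      rw [List.map_cons, List.nodup_cons] at this
      exact this.1
    have hd : ∀ w ∈ ((x, t) :: xs.zip D).map Prod.fst, w ∉ ((x, t) :: xs.zip D).map Prod.snd :=
      fun w hw hw' => (List.nodup_append.1 hn1).2.2 w hw w hw' rfl
    funext s w
    rw [Function.comp_apply, LCU.ladder, ladderBit_congr (s' := s) (fun w hw =>
      ladder_of_notMem (hd w (List.mem_cons_of_mem _ hw)) s), LCU.ladder, ladderBit]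
    by_cases hw : w = t
    · subst hw
      rw [if_pos rfl, ladderBit_of_notMem ht, toggle_same, h1, add_zero]
    · rw [if_neg hw, toggle_of_ne hw, add_bit_add_bit]

/-- The multi-controlled `NOT` with the help of a single borrowed wire. -/
theorem Realizes.allOnes {C : List (Fin k)} {t a : Fin k} (hn : (C ++ [t, a]).Nodup) :
    Realizes (toggle t (LCU.allOnes C)) (8 * C.length + 12) := by
  set m := (C.length + 1) / 2 with hm
  set A := C.take m with hA
  set B := C.drop m with hB
  have hAB : A ++ B = C := List.take_append_drop _ _
  have lA : A.length = m := by rw [hA, List.length_take]; omega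
  have lB : B.length = C.length - m := by rw [hB, List.length_drop]
  rw [← hAB] at hn
  have p1 : (A ++ a :: (B ++ [t])).Nodup := by
    refine (List.Perm.nodup_iff ?_).1 hn
    rw [List.perm_iff_count]
    intro x
    simp only [List.count_append, List.count_cons, List.count_nil]
    omega
  have p2 : ((a :: B) ++ t :: A).Nodup := by
    refine (List.Perm.nodup_iff ?_).1 hn
    rw [List.perm_iff_count]
    intro x
    simp only [List.count_append, List.count_cons, List.count_nil]
    omega
  have r1 := Realizes.allOnes_of_borrowed p1 (by
    simp only [List.length_append, List.length_singleton]; omega)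
  have r2 := Realizes.allOnes_of_borrowed p2 (by simp only [List.length_cons]; omega)
  -- `r1` adds the conjunction of `A` to `a`, and `r2` adds a times the conjunction of `B` to `t`.
  -- Done twice, `a` returns to its value and `t` changes by the conjunction of `A` and `B`. Each
  -- half supplies the borrowed wires for the other.
  convert ((r2.comp r1).comp (r2.comp r1)).mono
    (show _ ≤ 8 * C.length + 12 by simp only [List.length_cons]; omega) using 1
  have hat : a ≠ t := by
    rintro rfl
    simp [List.nodup_append] at p1
  have htA : t ∉ A := fun h => by
    have := (List.nodup_append.1 hn).2.2 t (List.mem_append_left _ h) t (by simp)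
    exact this rfl
  have htB : t ∉ B := fun h => by
    have := (List.nodup_append.1 hn).2.2 t (List.mem_append_right _ h) t (by simp)
    exact this rfl
  have haA : a ∉ A := fun h => by
    have := (List.nodup_append.1 hn).2.2 a (List.mem_append_left _ h) a (by simp)
    exact this rfl
  have haB : a ∉ B := fun h => by
    have := (List.nodup_append.1 hn).2.2 a (List.mem_append_right _ h) a (by simp)
    exact this rfl
  have inv : ∀ {W : List (Fin k)} {u : Fin k}, u ∉ W → ∀ (b : BasisState k → Fin 2) s,
      LCU.allOnes W (toggle u b s) = LCU.allOnes W s := fun hu b s =>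
    allOnes_congr fun w hw => toggle_of_ne (ne_of_mem_of_not_mem hw hu) _ _
  funext s w
  simp only [Function.comp_apply]
  by_cases hw : w = t
  · subst hw
    simp only [toggle_same, toggle_of_ne hat.symm, toggle_of_ne hat, allOnes_cons, inv htA, inv htB,
      inv haA, inv haB, ← hAB, allOnes_append]
    generalize s w = x, s a = y, LCU.allOnes A s = z, LCU.allOnes B s = v
    revert x y z v; decide
  by_cases hw' : w = a
  · subst hw'
    simp only [toggle_same, toggle_of_ne hw, inv htA, inv haA, add_bit_add_bit]
  · simp only [toggle_of_ne hw, toggle_of_ne hw']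

/-! ### The increment with a single borrowed wire -/

/-- A carry enters the high part exactly when the low part is all ones. The high part must be
updated first, while `L` still holds its old value. -/
theorem Adds.append {L H : List (Fin k)} (hn : (L ++ H).Nodup) {f g : BasisState k → BasisState k}
    (hf : Adds H (fun s => (allOnes L s : ℕ)) f) (hg : Adds L (fun _ => 1) g) :
    Adds (L ++ H) (fun _ => 1) (g ∘ f) := by
  intro s
  obtain ⟨f1, f2⟩ := hf s
  obtain ⟨g1, g2⟩ := hg (f s)
  have hd : ∀ w ∈ L, w ∉ H := fun w hw hw' => (List.nodup_append.1 hn).2.2 w hw w hw' rfl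
  beta_reduce at f2 g2 ⊢
  rw [Function.comp_apply]
  constructor
  · intro w hw
    rw [List.mem_append, not_or] at hw
    rw [g1 w hw.1, f1 w hw.2]
  · have vL : val (f s) L = val s L := val_congr fun w hw => f1 w (hd w hw)
    have vH : val (g (f s)) H = val (f s) H := val_congr fun w hw => g1 w fun h => hd w h hw
    rw [vL] at g2
    rw [val_append, val_append, vH, List.length_append, pow_add]
    have b0 := val_nonneg (g (f s)) L
    have b1 := val_lt (g (f s)) L
    have b2 := val_nonneg s L
    by_cases h : ∀ w ∈ L, s w = 1
    · have e1 : val (g (f s)) L = 0 := by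
        rw [val_eq_of_allOnes h] at g2
        rw [Int.ModEq, Int.emod_eq_of_lt b0 b1] at g2
        rw [g2]; simp
      have e2 : allOnes L s = 1 := if_pos h
      rw [e2] at f2
      rw [e1, val_eq_of_allOnes h]
      refine (Int.ModEq.add_left 0 f2.mul_left').trans (modEq_of_eq ?_)
      simp; ring
    · have b3 := val_lt_of_not_allOnes h
      have e1 : val (g (f s)) L = val s L + 1 := by
        rw [Int.ModEq, Int.emod_eq_of_lt b0 b1, Int.emod_eq_of_lt (by omega) b3] at g2
        exact g2
      have e2 : allOnes L s = 0 := if_neg h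
      rw [e2] at f2
      rw [e1]
      refine (Int.ModEq.add_left _ f2.mul_left').trans (modEq_of_eq ?_)
      simp; ring

/-- With `a` as lowest bit, an increment flips `a` and carries into `H` exactly when `a` was 1;
flipping `a` back leaves an increment of `H` controlled by `a`. -/
theorem Adds.controlled {H : List (Fin k)} {a : Fin k} (ha : a ∉ H)
    {f : BasisState k → BasisState k} (hf : Adds (a :: H) (fun _ => 1) f) :
    Adds H (fun s => (s a : ℕ)) (toggle a (fun _ => 1) ∘ f) := by
  intro s
  obtain ⟨f1, f2⟩ := hf s
  beta_reduce at f2 ⊢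
  rw [Function.comp_apply]
  have vH : val (toggle a (fun _ => 1) (f s)) H = val (f s) H :=
    val_congr fun w hw => toggle_of_ne (ne_of_mem_of_not_mem hw ha) _ _
  rw [vH]
  obtain ⟨q, hq⟩ := f2.symm.dvd
  rw [val, val, List.length_cons, pow_succ, mul_comm _ (2 : ℤ), mul_assoc] at hq
  have i1 := (s a).isLt
  have i2 := (f s a).isLt
  -- Reading the congruence modulo 2 determines the lowest bit.
  have e : f s a = s a + 1 := by
    have : ∀ x y : Fin 2, ((x : ℕ) + (y : ℕ)) % 2 = 1 → x = y + 1 := by decide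
    exact this _ _ (by omega)
  constructor
  · intro w hw
    by_cases hwa : w = a
    · subst hwa
      rw [toggle_same, e, add_bit_add_bit]
    · rw [toggle_of_ne hwa, f1 w (by simp [hwa, hw])]
  · refine Int.ModEq.symm ((Int.modEq_iff_dvd).2 ⟨q, ?_⟩)
    have : ∀ x : Fin 2, ((x + 1 : Fin 2) : ℕ) + (x : ℕ) = 1 := by decide
    have := this (s a)
    rw [e] at hq
    omega

/-- The increment of an odd number of wires, split in two halves. -/
theorem exists_adds_one_of_halves {L H : List (Fin k)} {a : Fin k} (hn : (L ++ H ++ [a]).Nodup)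
    (hl : L.length = H.length + 1) :
    ∃ f, Adds (L ++ H) (fun _ => 1) f ∧ Realizes f (70 * (L ++ H).length + 20) := by
  have n1 : (a :: H ++ L).Nodup := by
    refine (List.Perm.nodup_iff ?_).1 hn
    rw [List.perm_iff_count]
    intro x
    simp only [List.count_append, List.count_cons, List.count_nil]
    omega
  have n2 : (L ++ a :: H).Nodup := (List.Perm.nodup_iff List.perm_append_comm).1 n1
  have nLH := (List.nodup_append.1 hn).1
  have haH : a ∉ H := (List.nodup_cons.1 (List.nodup_append.1 n1).1).1
  have hd : ∀ w ∈ L, w ∉ a :: H := fun w hw hw' => (List.nodup_append.1 n2).2.2 w hw w hw' rfl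
  obtain ⟨f, hf, fm⟩ := exists_adds_one_of_borrowed n1 (by simp [hl])
  have hc := hf.controlled haH
  have cm := (Realizes.not a).comp fm
  have tm := Realizes.allOnes_of_borrowed n2 (by simp [hl])
  -- The increment of `H` controlled by `a` becomes the addition of the carry out of `L`, although
  -- `a` is only borrowed. `L` lends its wires to the controlled increment, and `H` lends its own to
  -- the conjunction of `L`.
  obtain ⟨g, hg, gm⟩ := exists_adds_bit (List.nodup_append.1 nLH).2.1 haH (v := fun _ => 0)
    (b := allOnes L) (fun _ _ _ => rfl)
    (fun s s' h => allOnes_congr fun w hw => h w (fun e => hd w hw (List.mem_cons_of_mem _ e))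
      fun e => hd w hw (e ▸ List.mem_cons_self))
    (by simpa using hc) cm tm
  obtain ⟨e, he, em⟩ := exists_adds_one_of_borrowed n2 (by simp [hl])
  refine ⟨_, hg.append nLH he, (em.comp gm).mono ?_⟩
  simp only [List.length_cons, List.length_append]
  omega

/-- The increment of a register with the help of a single borrowed wire. -/
theorem exists_adds_one {R : List (Fin k)} {a : Fin k} (hn : (R ++ [a]).Nodup) :
    ∃ f, Adds R (fun _ => 1) f ∧ Realizes f (80 * R.length + 30) := by
  have odd : ∀ R : List (Fin k), (R ++ [a]).Nodup → R.length % 2 = 1 →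
      ∃ f, Adds R (fun _ => 1) f ∧ Realizes f (70 * R.length + 20) := by
    intro R hn hR
    set m := (R.length + 1) / 2 with hm
    have := exists_adds_one_of_halves (L := R.take m) (H := R.drop m) (a := a)
      (by rwa [List.take_append_drop]) (by rw [List.length_take, List.length_drop]; omega)
    rwa [List.take_append_drop] at this
  rcases Nat.mod_two_eq_zero_or_one R.length with hR | hR
  -- For even positive length the top bit `t` is split off: it flips when all lower bits are 1, and
  -- the odd case handles the rest.
  · rcases List.eq_nil_or_concat' R with rfl | ⟨L, t, rfl⟩
    · exact ⟨_, fun s => ⟨fun _ _ => rfl, by simp [val, Int.modEq_one]⟩,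
        Realizes.id.mono (Nat.zero_le _)⟩
    · have hL := (List.nodup_append.1 hn).1
      have hta : (L ++ [t, a]).Nodup := by simpa using hn
      obtain ⟨f, hf, fm⟩ := odd L (hta.sublist (List.Sublist.append_left (by simp) _))
        (by simp at hR; omega)
      refine ⟨_, Adds.append hL (f := toggle t (allOnes L)) ?_ hf,
        (fm.comp (Realizes.allOnes hta)).mono (by simp; omega)⟩
      intro s
      constructor
      · intro w hw
        exact toggle_of_ne (by simpa using hw) _ _
      · simp only [val, toggle_same, List.length_singleton]
        generalize s t = x, allOnes L s = y
        revert x y; decide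
  · obtain ⟨f, hf, fm⟩ := odd R hn hR
    exact ⟨f, hf, fm.mono (by omega)⟩

/-! ### Signed permutation matrices -/

/-- The matrix sending the basis state `x` to `φ x` times the basis state `f x`. -/
def signedMap (φ : BasisState k → ℂ) (f : BasisState k → BasisState k) :
    Matrix (BasisState k) (BasisState k) ℂ :=
  Matrix.of fun y x => if y = f x then φ x else 0

theorem signedMap_apply (φ : BasisState k → ℂ) (f : BasisState k → BasisState k)
    (y x : BasisState k) : signedMap φ f y x = if y = f x then φ x else 0 := rfl

theorem signedMap_mul (φ ψ : BasisState k → ℂ) (f g : BasisState k → BasisState k) :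
    signedMap ψ g * signedMap φ f = signedMap (fun x => φ x * ψ (f x)) (g ∘ f) := by
  ext y x
  rw [Matrix.mul_apply, Finset.sum_eq_single (f x)]
  · simp only [signedMap_apply, if_true, Function.comp_apply]
    split_ifs <;> ring
  · intro z _ hz
    simp [signedMap_apply, hz]
  · simp

theorem signedMap_one : signedMap (fun _ => 1) id = (1 : Matrix (BasisState k) (BasisState k) ℂ) := by
  ext y x
  simp [signedMap_apply, Matrix.one_apply]

theorem ofBasis_apply (M : Matrix (BasisState k) (BasisState k) ℂ) (y x : BasisState k) :
    ofBasis M (binIdx k y) (binIdx k x) = M y x := by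
  simp [ofBasis]

theorem ext_binIdx {A B : Op k}
    (h : ∀ y x, A (binIdx k y) (binIdx k x) = B (binIdx k y) (binIdx k x)) : A = B := by
  ext i j
  obtain ⟨y, rfl⟩ := (binIdx k).surjective i
  obtain ⟨x, rfl⟩ := (binIdx k).surjective j
  exact h y x

theorem ofBasis_mul (M N : Matrix (BasisState k) (BasisState k) ℂ) :
    ofBasis (M * N) = ofBasis M * ofBasis N :=
  (Matrix.submatrix_mul_equiv M N _ _ _).symm

theorem ofBasis_one : ofBasis (1 : Matrix (BasisState k) (BasisState k) ℂ) = 1 := by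
  simp [ofBasis]

theorem ofBasis_conjTranspose (M : Matrix (BasisState k) (BasisState k) ℂ) :
    ofBasis Mᴴ = (ofBasis M)ᴴ := rfl

/-! ### The gates as signed permutation matrices -/

/-- The sign of a bit. -/
def sgn (b : Fin 2) : ℂ := if b = 1 then -1 else 1

theorem sgn_add (a b : Fin 2) : sgn (a + b) = sgn a * sgn b := by
  fin_cases a <;> fin_cases b <;> simp [sgn]

theorem onQubit_eq (t : Fin k) (G : Matrix (Fin 2) (Fin 2) ℂ) :
    onQubit t G = ofBasis (Matrix.of fun y x => if ∀ q, q ≠ t → y q = x q then G (y t) (x t) else 0) := by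
  unfold onQubit tensor
  congr 1
  ext y x
  simp only [Matrix.of_apply]
  rw [← Finset.mul_prod_erase _ _ (Finset.mem_univ t), Function.update_self]
  have h : ∀ q ∈ Finset.univ.erase t,
      Function.update (fun _ : Fin k => (1 : Matrix (Fin 2) (Fin 2) ℂ)) t G q (y q) (x q)
        = if y q = x q then 1 else 0 := by
    intro q hq
    rw [Function.update_of_ne (Finset.ne_of_mem_erase hq), Matrix.one_apply]
  rw [Finset.prod_congr rfl h, Finset.prod_ite_zero]
  simp

theorem onQubit_mul (t : Fin k) (G G' : Matrix (Fin 2) (Fin 2) ℂ) :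
    onQubit t G * onQubit t G' = onQubit t (G * G') := by
  unfold onQubit tensor
  rw [← ofBasis_mul]
  congr 1
  ext y x
  simp only [Matrix.mul_apply, Matrix.of_apply, ← Finset.prod_mul_distrib]
  rw [← Fintype.prod_sum (fun q z =>
    Function.update (fun _ : Fin k => (1 : Matrix (Fin 2) (Fin 2) ℂ)) t G q (y q) z *
    Function.update (fun _ : Fin k => (1 : Matrix (Fin 2) (Fin 2) ℂ)) t G' q z (x q))]
  refine Finset.prod_congr rfl fun q _ => ?_
  rw [← Matrix.mul_apply]
  by_cases hq : q = t
  · subst hq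
    simp [Matrix.mul_apply]
  · simp [Function.update_of_ne hq]

theorem onQubit_one (t : Fin k) : onQubit t 1 = 1 := by
  rw [onQubit_eq, ← ofBasis_one]
  congr 1
  ext y x
  simp only [Matrix.of_apply, Matrix.one_apply]
  by_cases h : y = x
  · simp [h]
  · rw [if_neg h]
    split_ifs with h1 h2
    · exact absurd (funext fun q => if hq : q = t then hq ▸ h2 else h1 q hq) h
    · rfl
    · rfl

theorem onQubit_conjTranspose (t : Fin k) {G : Matrix (Fin 2) (Fin 2) ℂ} (hG : Gᴴ = G) :
    (onQubit t G)ᴴ = onQubit t G := by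
  rw [onQubit_eq, ← ofBasis_conjTranspose]
  congr 1
  ext y x
  simp only [Matrix.conjTranspose_apply, Matrix.of_apply]
  have hs : star (G (x t) (y t)) = G (y t) (x t) := by
    rw [← Matrix.conjTranspose_apply, hG]
  rw [apply_ite star, hs, star_zero]
  simp only [eq_comm]

theorem onQubit_pauliX (t : Fin k) :
    onQubit t pauliX = ofBasis (signedMap (fun _ => 1) (toggle t fun _ => 1)) := by
  rw [onQubit_eq]
  congr 1
  ext y x
  have hX : ∀ a b : Fin 2, pauliX a b = if a = b + 1 then 1 else 0 := by
    intro a b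
    fin_cases a <;> fin_cases b <;> simp [pauliX]
  simp only [Matrix.of_apply, signedMap_apply, hX]
  have : y = toggle t (fun _ => 1) x ↔ (∀ q, q ≠ t → y q = x q) ∧ y t = x t + 1 := by
    rw [toggle, Function.eq_update_iff, and_comm]
  simp only [this]
  split_ifs <;> tauto

theorem onQubit_pauliZ (t : Fin k) :
    onQubit t pauliZ = ofBasis (signedMap (fun x => sgn (x t)) id) := by
  rw [onQubit_eq]
  congr 1
  ext y x
  have hZ : ∀ a b : Fin 2, pauliZ a b = if a = b then sgn b else 0 := by
    intro a b
    fin_cases a <;> fin_cases b <;> simp [pauliZ, sgn]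
  simp only [Matrix.of_apply, signedMap_apply, hZ, id]
  by_cases h : y = x
  · simp [h]
  · rw [if_neg h]
    split_ifs with h1 h2
    · exact absurd (funext fun q => if hq : q = t then hq ▸ h2 else h1 q hq) h
    · rfl
    · rfl

theorem ctrlNot_eq (C : Finset (Fin k)) (t : Fin k) {b : BasisState k → Fin 2}
    (hb : ∀ x, b x = if ∀ c ∈ C, x c = 1 then 1 else 0) :
    ctrlNot C t = ofBasis (signedMap (fun _ => 1) (toggle t b)) := by
  unfold ctrlNot signedMap
  congr 1
  ext y x
  simp only [Matrix.of_apply]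
  congr 2
  rw [toggle, hb]
  split_ifs
  · rfl
  · rw [add_zero, Function.update_eq_self]

theorem Gate.op_of_isClassical {g : Gate k} (hg : g.isClassical = true) :
    g.op = ofBasis (signedMap (fun _ => 1) g.act) := by
  cases g with
  | X t => exact onQubit_pauliX t
  | Z t => simp [Gate.isClassical] at hg
  | H t => simp [Gate.isClassical] at hg
  | CNOT c t h =>
    refine ctrlNot_eq _ _ fun x => ?_
    have : ∀ a : Fin 2, a = if a = 1 then 1 else 0 := by decide
    simpa using this (x c)
  | Toffoli c₁ c₂ t h h₁ h₂ =>
    refine ctrlNot_eq _ _ fun x => ?_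
    have : ∀ a b : Fin 2, a * b = if a = 1 ∧ b = 1 then 1 else 0 := by decide
    simpa using this (x c₁) (x c₂)

theorem hadamard_apply (a b : Fin 2) :
    hadamard a b = ((1 / Real.sqrt 2 : ℝ) : ℂ) * sgn (a * b) := by
  fin_cases a <;> fin_cases b <;> simp [hadamard, sgn]

theorem hadamard_mul_self : hadamard * hadamard = 1 := by
  have h : ((1 / Real.sqrt 2 : ℝ) : ℂ) * ((1 / Real.sqrt 2 : ℝ) : ℂ) = 1 / 2 := by
    rw [← Complex.ofReal_mul, div_mul_div_comm, Real.mul_self_sqrt zero_le_two]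
    norm_num
  ext a b
  rw [Matrix.mul_apply, Fin.sum_univ_two]
  simp only [hadamard_apply]
  fin_cases a <;> fin_cases b <;> simp [sgn] <;> simp at h <;> linear_combination 2 * h

theorem onQubit_hadamard_mul_self (t : Fin k) :
    onQubit t hadamard * onQubit t hadamard = 1 := by
  rw [onQubit_mul, hadamard_mul_self, onQubit_one]

/-- Conjugation by Hadamard gates turns a controlled `NOT` into a controlled phase. -/
theorem hadamard_conj_toggle (t : Fin k) {b : BasisState k → Fin 2}
    (hb : ∀ x x' : BasisState k, (∀ w, w ≠ t → x w = x' w) → b x = b x') :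
    onQubit t hadamard * (ofBasis (signedMap (fun _ => 1) (toggle t b)) * onQubit t hadamard)
      = ofBasis (signedMap (fun x => sgn (b x * x t)) id) := by
  have key : ofBasis (signedMap (fun _ => 1) (toggle t b)) * onQubit t hadamard
      = onQubit t hadamard * ofBasis (signedMap (fun x => sgn (b x * x t)) id) := by
    rw [onQubit_eq, ← ofBasis_mul, ← ofBasis_mul]
    congr 1
    ext y x
    have ht : ∀ z, toggle t b (toggle t b z) = z := by
      intro z
      have hbz : b (toggle t b z) = b z := hb _ _ fun w hw => toggle_of_ne hw _ _
      funext w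
      by_cases hw : w = t
      · subst hw
        rw [toggle_same, toggle_same, hbz, add_bit_add_bit]
      · rw [toggle_of_ne hw, toggle_of_ne hw]
    -- Each product has one surviving term per entry, and the two agree because (y + b)x = yx + bx
    -- in the exponent of the Hadamard sign.
    rw [Matrix.mul_apply, Matrix.mul_apply, Finset.sum_eq_single (toggle t b y),
      Finset.sum_eq_single x]
    · simp only [signedMap_apply, Matrix.of_apply, ht, if_true, id, one_mul, toggle_same]
      have hc : (∀ q, q ≠ t → toggle t b y q = x q) ↔ ∀ q, q ≠ t → y q = x q :=
        forall₂_congr fun q hq => by rw [toggle_of_ne hq]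
      simp only [hc]
      split_ifs with h
      · rw [← hb y x h, hadamard_apply, hadamard_apply, mul_assoc, ← sgn_add]
        congr 2
        generalize y t = p, b y = q, x t = r
        revert p q r; decide
      · rw [zero_mul]
    · intro z _ hz
      simp [signedMap_apply, hz]
    · simp
    · intro z _ hz
      rw [signedMap_apply, if_neg, zero_mul]
      rintro rfl
      exact hz (ht z).symm
    · simp
  rw [key, ← mul_assoc, onQubit_hadamard_mul_self, one_mul]

/-! ### Circuits acting as signed permutations, with gate counts -/

theorem Circuit.op_append (P Q : Circuit k) : Circuit.op (P ++ Q) = Q.op * P.op := by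
  induction P with
  | nil => simp [Circuit.op]
  | cons g gs ih => rw [List.cons_append, Circuit.op, Circuit.op, ih, mul_assoc]

theorem Circuit.op_of_isClassical {Q : Circuit k} (hQ : ∀ g ∈ Q, g.isClassical = true) :
    Q.op = ofBasis (signedMap (fun _ => 1) Q.run) := by
  induction Q with
  | nil => rw [Circuit.op, Circuit.run, signedMap_one, ofBasis_one]
  | cons g gs ih =>
    rw [Circuit.op, Circuit.run, ih fun g hg => hQ g (List.mem_cons_of_mem _ hg),
      Gate.op_of_isClassical (hQ g List.mem_cons_self), ← ofBasis_mul, signedMap_mul]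
    simp

/-- Some circuit with at most `z` gates `Z`, `h` Hadamard gates and `c` classical gates has the
matrix `A`. -/
def Attains (A : Op k) (z h c : ℕ) : Prop :=
  ∃ Q : Circuit k, Q.op = A ∧ Q.countP Gate.isZ ≤ z ∧ Q.countP Gate.isH ≤ h ∧
    Q.countP Gate.isClassical ≤ c

theorem Attains.mono {A : Op k} {z h c z' h' c' : ℕ} (H : Attains A z h c) (hz : z ≤ z')
    (hh : h ≤ h') (hc : c ≤ c') : Attains A z' h' c' := by
  obtain ⟨Q, h1, h2, h3, h4⟩ := H
  exact ⟨Q, h1, h2.trans hz, h3.trans hh, h4.trans hc⟩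

theorem Attains.mul {A B : Op k} {z h c z' h' c' : ℕ} (hA : Attains A z h c)
    (hB : Attains B z' h' c') : Attains (A * B) (z + z') (h + h') (c + c') := by
  obtain ⟨Q, q1, q2, q3, q4⟩ := hA
  obtain ⟨P, p1, p2, p3, p4⟩ := hB
  refine ⟨P ++ Q, by rw [Circuit.op_append, q1, p1], ?_, ?_, ?_⟩ <;> rw [List.countP_append] <;>
    omega

theorem Realizes.attains {f : BasisState k → BasisState k} {m : ℕ} (h : Realizes f m) :
    Attains (ofBasis (signedMap (fun _ => 1) f)) 0 0 m := by
  obtain ⟨Q, h1, h2, h3⟩ := h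
  refine ⟨Q, by rw [Circuit.op_of_isClassical h1, h3], ?_, ?_, List.countP_le_length.trans h2⟩
  · rw [Nat.le_zero, List.countP_eq_zero]
    intro g hg
    have := h1 g hg
    cases g <;> simp_all [Gate.isClassical, Gate.isZ]
  · rw [Nat.le_zero, List.countP_eq_zero]
    intro g hg
    have := h1 g hg
    cases g <;> simp_all [Gate.isClassical, Gate.isH]

theorem attains_pauliZ (t : Fin k) :
    Attains (ofBasis (signedMap (fun x => sgn (x t)) id)) 1 0 0 :=
  ⟨[.Z t], by simp [Circuit.op, Gate.op, onQubit_pauliZ], by simp [Gate.isZ], by simp [Gate.isH],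
    by simp [Gate.isClassical]⟩

theorem attains_hadamard (t : Fin k) : Attains (onQubit t hadamard) 0 1 0 :=
  ⟨[.H t], by simp [Circuit.op, Gate.op], by simp [Gate.isZ], by simp [Gate.isH],
    by simp [Gate.isClassical]⟩

theorem Realizes.attains_phase {t : Fin k} {b : BasisState k → Fin 2} {m : ℕ}
    (h : Realizes (toggle t b) m)
    (hb : ∀ x x' : BasisState k, (∀ w, w ≠ t → x w = x' w) → b x = b x') :
    Attains (ofBasis (signedMap (fun x => sgn (b x * x t)) _root_.id)) 0 2 m := by
  rw [← hadamard_conj_toggle t hb]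
  exact ((attains_hadamard t).mul (h.attains.mul (attains_hadamard t))).mono (by omega) (by omega)
    (by omega)

theorem attains_signedMap_comp {φ ψ : BasisState k → ℂ} {f g : BasisState k → BasisState k}
    {z h c z' h' c' : ℕ} (hg : Attains (ofBasis (signedMap ψ g)) z h c)
    (hf : Attains (ofBasis (signedMap φ f)) z' h' c') :
    Attains (ofBasis (signedMap (fun x => φ x * ψ (f x)) (g ∘ f))) (z + z') (h + h') (c + c') := by
  rw [← signedMap_mul, ofBasis_mul]
  exact hg.mul hf

/-! ### Unitarity -/

/-- Every elementary gate is a Hermitian involution. -/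
theorem Gate.op_mem_unitaryGroup (g : Gate k) : g.op ∈ Matrix.unitaryGroup (Fin (2 ^ k)) ℂ := by
  have inv : ∀ {t : Fin k} {b : BasisState k → Fin 2},
      (∀ x x' : BasisState k, (∀ w, w ≠ t → x w = x' w) → b x = b x') →
      ofBasis (signedMap (fun _ => 1) (toggle t b)) ∈ Matrix.unitaryGroup (Fin (2 ^ k)) ℂ := by
    intro t b hb
    have hbz : ∀ z, b (toggle t b z) = b z := fun z => hb _ _ fun w hw => toggle_of_ne hw _ _
    have ht : ∀ z, toggle t b (toggle t b z) = z := by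
      intro z
      funext w
      by_cases hw : w = t
      · subst hw
        rw [toggle_same, toggle_same, hbz, add_bit_add_bit]
      · rw [toggle_of_ne hw, toggle_of_ne hw]
    have hs : star (ofBasis (signedMap (fun _ => 1) (toggle t b)))
        = ofBasis (signedMap (fun _ => 1) (toggle t b)) := by
      rw [Matrix.star_eq_conjTranspose, ← ofBasis_conjTranspose]
      congr 1
      ext y x
      rw [Matrix.conjTranspose_apply, signedMap_apply, signedMap_apply, apply_ite star, star_one,
        star_zero]
      congr 1
      exact propext ⟨fun h => by rw [h, ht], fun h => by rw [h, ht]⟩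
    rw [Matrix.mem_unitaryGroup_iff, hs, ← ofBasis_mul, signedMap_mul,
      show toggle t b ∘ toggle t b = id from funext ht]
    simp only [mul_one]
    rw [signedMap_one, ofBasis_one]
  have one : ∀ (t : Fin k) {G : Matrix (Fin 2) (Fin 2) ℂ}, Gᴴ = G → G * G = 1 →
      onQubit t G ∈ Matrix.unitaryGroup (Fin (2 ^ k)) ℂ := by
    intro t G h1 h2
    rw [Matrix.mem_unitaryGroup_iff, Matrix.star_eq_conjTranspose, onQubit_conjTranspose t h1,
      onQubit_mul, h2, onQubit_one]
  cases g with
  | X t =>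
    refine one t ?_ ?_ <;> ext a b <;> fin_cases a <;> fin_cases b <;> simp [pauliX]
  | Z t =>
    refine one t ?_ ?_ <;> ext a b <;> fin_cases a <;> fin_cases b <;> simp [pauliZ]
  | H t =>
    refine one t ?_ hadamard_mul_self
    ext a b
    rw [Matrix.conjTranspose_apply, hadamard_apply, hadamard_apply, mul_comm a b, star_mul']
    congr 1
    · exact Complex.conj_ofReal _
    · rw [sgn]; split_ifs <;> simp
  | CNOT c t h =>
    rw [Gate.op_of_isClassical rfl]
    exact inv fun x x' hx => hx c h
  | Toffoli c₁ c₂ t h h₁ h₂ =>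
    rw [Gate.op_of_isClassical rfl]
    exact inv fun x x' hx => by rw [hx c₁ h₁, hx c₂ h₂]

theorem Circuit.op_mem_unitaryGroup (Q : Circuit k) :
    Q.op ∈ Matrix.unitaryGroup (Fin (2 ^ k)) ℂ := by
  induction Q with
  | nil => exact one_mem _
  | cons g gs ih => exact mul_mem ih g.op_mem_unitaryGroup

theorem Implements.mem_unitaryGroup {n : ℕ} {Q : Circuit (n + 1)} {U : Op n}
    (h : Implements Q U) : U ∈ Matrix.unitaryGroup (Fin (2 ^ n)) ℂ := by
  have hu := Q.op_mem_unitaryGroup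
  rw [show Q.op = withAncilla U from h, Matrix.mem_unitaryGroup_iff,
    Matrix.star_eq_conjTranspose] at hu
  rw [Matrix.mem_unitaryGroup_iff, Matrix.star_eq_conjTranspose]
  have h1 : (withAncilla U)ᴴ = withAncilla Uᴴ := by
    simp only [withAncilla, Matrix.conjTranspose_reindex, Matrix.conjTranspose_kronecker,
      Matrix.conjTranspose_one]
  have h2 : withAncilla U * withAncilla Uᴴ = withAncilla (U * Uᴴ) := by
    simp only [withAncilla, Matrix.reindex_apply, Matrix.submatrix_mul_equiv,
      ← Matrix.mul_kronecker_mul, mul_one]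
  rw [h1, h2] at hu
  ext i j
  obtain ⟨e, he⟩ : ∃ e, e = finProdFinEquiv.trans (finCongr (pow_succ 2 n).symm) := ⟨_, rfl⟩
  -- The block with ancilla 0 recovers the operator, so U Uᴴ = 1 can be read off there.
  have hW : ∀ V : Op n, withAncilla V (e (i, 0)) (e (j, 0)) = V i j := by
    intro V
    rw [withAncilla, ← he, Matrix.reindex_apply, Matrix.submatrix_apply, Equiv.symm_apply_apply,
      Equiv.symm_apply_apply, Matrix.kroneckerMap_apply, Matrix.one_apply_eq, mul_one]
  rw [← hW (U * Uᴴ), hu, Matrix.one_apply, Matrix.one_apply]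
  simp

/-! ### The data wires -/

theorem val_reverse_finRange {n : ℕ} (e : Fin n → Fin k) (x : BasisState k) :
    val x ((List.finRange n).reverse.map e) = ((binIdx n (x ∘ e) : ℕ) : ℤ) := by
  have H : ∀ (n : ℕ) (e : Fin n → Fin k), val x ((List.finRange n).reverse.map e)
      = ∑ q : Fin n, ((x (e q) : ℕ) : ℤ) * 2 ^ (n - 1 - (q : ℕ)) := by
    intro n
    induction n with
    | zero => intro e; simp [val]
    | succ n ih =>
      intro e
      have h := ih (e ∘ Fin.succ)
      rw [List.finRange_succ, List.reverse_cons, List.map_append, ← List.map_reverse, List.map_map,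
        val_append, h, Fin.sum_univ_succ]
      simp only [List.length_map, List.length_reverse, List.length_finRange, List.map_cons,
        List.map_nil, val, Function.comp_apply, Fin.val_succ, Fin.val_zero]
      rw [add_comm]
      congr 1
      · simp [mul_comm]
      · refine Finset.sum_congr rfl fun q _ => ?_
        congr 2
        omega
  rw [H, binIdx_val]
  push_cast
  rfl

theorem binIdx_add_binIdx {n : ℕ} (y x : BasisState n) :
    (binIdx n y : ℕ) + (binIdx n x : ℕ) + 1 = 2 ^ n ↔ ∀ q, y q = x q + 1 := by
  have hv : ∀ z : BasisState n, val z ((List.finRange n).reverse.map id) = ((binIdx n z : ℕ) : ℤ) :=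
    fun z => val_reverse_finRange id z
  have hflip := val_flip (s := x) (s' := fun q => x q + 1)
    (R := (List.finRange n).reverse.map id) fun _ _ => rfl
  rw [hv, hv, List.length_map, List.length_reverse, List.length_finRange] at hflip
  have h2 : ((binIdx n fun q => x q + 1 : Fin (2 ^ n)) : ℕ) + (binIdx n x : ℕ) + 1 = 2 ^ n := by
    zify
    linarith
  constructor
  · intro h
    have : binIdx n y = binIdx n fun q => x q + 1 := Fin.ext (by omega)
    exact congrFun ((binIdx n).injective this)
  · intro h
    rw [show y = fun q => x q + 1 from funext h]
    exact h2

theorem binIdx_eq_zero {n : ℕ} (x : BasisState n) : (binIdx n x : ℕ) = 0 ↔ ∀ q, x q = 0 := by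
  rw [binIdx_val, Finset.sum_eq_zero_iff]
  refine forall_congr' fun q => ?_
  rw [mul_eq_zero_iff_right (by positivity)]
  simp only [Finset.mem_univ, true_imp_iff]
  exact Fin.val_eq_zero_iff

theorem binIdx_succ_val {n : ℕ} (x : BasisState (n + 1)) :
    (binIdx (n + 1) x : ℕ) = x (Fin.last n) + 2 * (binIdx n (x ∘ Fin.castSucc) : ℕ) := by
  simp only [binIdx_val, Fin.sum_univ_castSucc, Finset.mul_sum, Function.comp_apply,
    Fin.val_castSucc, Fin.val_last]
  rw [add_comm]
  congr 1
  · simp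
  · refine Finset.sum_congr rfl fun q _ => ?_
    have hq := q.isLt
    obtain ⟨r, hr⟩ : ∃ r, n = q + r + 1 := ⟨n - 1 - q, by omega⟩
    have e1 : n + 1 - 1 - (q : ℕ) = r + 1 := by omega
    have e2 : n - 1 - (q : ℕ) = r := by omega
    rw [e1, e2, pow_succ]
    ring

theorem withAncilla_apply {n : ℕ} (U : Op n) (y x : BasisState (n + 1)) :
    withAncilla U (binIdx (n + 1) y) (binIdx (n + 1) x)
      = U (binIdx n (y ∘ Fin.castSucc)) (binIdx n (x ∘ Fin.castSucc)) *
        if y (Fin.last n) = x (Fin.last n) then 1 else 0 := by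
  have h : ∀ z : BasisState (n + 1), binIdx (n + 1) z
      = finProdFinEquiv.trans (finCongr (pow_succ 2 n).symm)
        (binIdx n (z ∘ Fin.castSucc), z (Fin.last n)) := by
    intro z
    ext
    simp only [Equiv.trans_apply, finCongr_apply, Fin.val_cast, finProdFinEquiv_apply_val,
      binIdx_succ_val]
  rw [h, h, withAncilla, Matrix.reindex_apply, Matrix.submatrix_apply, Equiv.symm_apply_apply,
    Equiv.symm_apply_apply, Matrix.kroneckerMap_apply, Matrix.one_apply]

theorem withAncilla_ofBasis {n : ℕ} {φ : BasisState n → ℂ} {f : BasisState n → BasisState n}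
    {ψ : BasisState (n + 1) → ℂ} {g : BasisState (n + 1) → BasisState (n + 1)}
    (hψ : ∀ x, ψ x = φ (x ∘ Fin.castSucc)) (hg : ∀ x, g x ∘ Fin.castSucc = f (x ∘ Fin.castSucc))
    (hl : ∀ x, g x (Fin.last n) = x (Fin.last n)) :
    withAncilla (ofBasis (signedMap φ f)) = ofBasis (signedMap ψ g) := by
  refine ext_binIdx fun y x => ?_
  rw [withAncilla_apply, ofBasis_apply, ofBasis_apply, signedMap_apply, signedMap_apply, hψ]
  have : y = g x ↔ y ∘ Fin.castSucc = f (x ∘ Fin.castSucc) ∧ y (Fin.last n) = x (Fin.last n) := by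
    rw [← hg x, ← hl x, funext_iff, Fin.forall_fin_succ', funext_iff]
    rfl
  simp only [this]
  split_ifs <;> simp_all

/-! ### The terms as signed permutation matrices -/

/-- Negate all bits. -/
def compl {n : ℕ} (x : BasisState n) : BasisState n := fun q => x q + 1

theorem tensorX_eq (n : ℕ) : tensorX n = ofBasis (signedMap (fun _ => 1) compl) := by
  unfold tensorX tensor
  congr 1
  ext y x
  have hX : ∀ a b : Fin 2, pauliX a b = if a = b + 1 then 1 else 0 := by
    intro a b
    fin_cases a <;> fin_cases b <;> simp [pauliX]
  simp only [Matrix.of_apply, signedMap_apply, hX, Finset.prod_ite_zero, Finset.prod_const_one]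
  simp only [Finset.mem_univ, true_imp_iff, funext_iff, compl]

theorem lastZ_eq (m : ℕ) :
    lastZ (m + 1) = ofBasis (signedMap (fun x => sgn (x (Fin.last m))) id) := by
  rw [← onQubit_pauliZ]
  unfold lastZ onQubit
  congr 1
  funext q
  by_cases h : q = Fin.last m
  · subst h; simp
  · rw [Function.update_of_ne h, if_neg]
    intro h'
    exact h (Fin.ext (by simpa using h'))

open Classical in
/-- The bit telling whether all bits of `x` are equal. -/
noncomputable def constBit {n : ℕ} (x : BasisState n) : Fin 2 :=
  if ∀ q r, x q = x r then 1 else 0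

/-- The corners belong to the indices 0 and N-1, the strings whose bits all agree; there the sign is
+1. -/
theorem antiDiagMinus_eq (m : ℕ) :
    antiDiagMinus (m + 1) = ofBasis (signedMap (fun x => sgn (1 + constBit x)) compl) := by
  refine ext_binIdx fun y x => ?_
  rw [ofBasis_apply, signedMap_apply, antiDiagMinus, Matrix.of_apply]
  simp only [binIdx_add_binIdx, binIdx_eq_zero]
  have hc : y = compl x ↔ ∀ q, y q = x q + 1 := funext_iff
  simp only [hc]
  by_cases h : ∀ q, y q = x q + 1
  · rw [if_pos h, if_pos h]
    have hb : ∀ a : Fin 2, a + 1 = 0 ↔ a = 1 := by decide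
    have h2 : ((∀ q, y q = 0) ∨ ∀ q, x q = 0) ↔ ∀ q r, x q = x r := by
      simp only [h, hb]
      constructor
      · rintro (h | h) q r <;> rw [h q, h r]
      · intro h
        have : x 0 = 0 ∨ x 0 = 1 := by generalize x 0 = a; revert a; decide
        rcases this with h0 | h0
        · exact Or.inr fun q => (h q 0).trans h0
        · exact Or.inl fun q => (h q 0).trans h0
    rw [constBit, if_congr h2 rfl rfl]
    by_cases h3 : ∀ q r, x q = x r
    · rw [if_pos h3, if_pos h3]; simp [sgn]
    · rw [if_neg h3, if_neg h3]; simp [sgn]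
  · rw [if_neg h, if_neg h]

/-! ### The decomposition -/

theorem tensorX_apply (n : ℕ) (i j : Fin (2 ^ n)) :
    tensorX n i j = if (i : ℕ) + j + 1 = 2 ^ n then 1 else 0 := by
  obtain ⟨y, rfl⟩ := (binIdx n).surjective i
  obtain ⟨x, rfl⟩ := (binIdx n).surjective j
  rw [tensorX_eq, ofBasis_apply, signedMap_apply]
  exact if_congr (by rw [binIdx_add_binIdx, funext_iff]; rfl) rfl rfl

theorem lastZ_mul_apply (m : ℕ) (M : Op (m + 1)) (i j : Fin (2 ^ (m + 1))) :
    (lastZ (m + 1) * M) i j = (if (i : ℕ) % 2 = 0 then 1 else -1) * M i j := by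
  have hz : ∀ l, lastZ (m + 1) i l = if i = l then (if (i : ℕ) % 2 = 0 then 1 else -1) else 0 := by
    intro l
    obtain ⟨y, rfl⟩ := (binIdx (m + 1)).surjective i
    obtain ⟨x, rfl⟩ := (binIdx (m + 1)).surjective l
    rw [lastZ_eq, ofBasis_apply, signedMap_apply, binIdx_succ_val]
    simp only [EmbeddingLike.apply_eq_iff_eq, id]
    by_cases h : y = x
    · subst h
      have : y (Fin.last m) = 0 ∨ y (Fin.last m) = 1 := by
        generalize y (Fin.last m) = a; revert a; decide
      rcases this with h | h <;> simp [sgn, h, Nat.add_mod]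
    · rw [if_neg h, if_neg h]
  rw [Matrix.mul_apply, Finset.sum_eq_single i]
  · rw [hz, if_pos rfl]
  · intro l _ hl
    rw [hz, if_neg hl.symm, zero_mul]
  · simp

theorem decomposition (n : ℕ) (hn : 1 ≤ n) (p : ℝ) :
    normLaplacian n + (p * meshSize n ^ 2) • centralDiff n
      = ∑ l : Fin 7, lcuCoeff n p l • lcuTerm n l := by
  obtain ⟨m, rfl⟩ : ∃ m, n = m + 1 := ⟨n - 1, by omega⟩
  have hm : meshSize (m + 1) ≠ 0 := by
    unfold meshSize
    positivity
  have e1 : meshSize (m + 1) ^ 2 * (1 / meshSize (m + 1) ^ 2) = 1 := by field_simp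
  have e2 : p * meshSize (m + 1) ^ 2 * (1 / (2 * meshSize (m + 1))) = p * meshSize (m + 1) / 2 := by
    field_simp
  rw [normLaplacian, dirichletLaplacian, centralDiff, smul_smul, smul_smul, e1, e2, one_smul]
  ext i j
  simp only [lcuCoeff, lcuTerm, Fin.sum_univ_succ, Fin.sum_univ_zero, Matrix.cons_val_zero,
    Matrix.cons_val_succ, Matrix.add_apply, Matrix.smul_apply, lastZ_mul_apply, tensorX_apply,
    Matrix.of_apply, antiDiagMinus, increment, Matrix.conjTranspose_apply, Complex.real_smul,
    Matrix.one_apply, Fin.ext_iff, Matrix.zero_apply]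
  generalize meshSize (m + 1) = h
  -- Only the evenness and positivity of N matter from here on: the corners are then distinct and
  -- lie in rows of opposite parity.
  have hN : ∃ M, 2 ^ (m + 1) = 2 * M ∧ 1 ≤ M :=
    ⟨2 ^ m, by rw [pow_succ]; ring, Nat.one_le_two_pow⟩
  obtain ⟨M, hM, hM1⟩ := hN
  have hi := i.isLt
  have hj := j.isLt
  generalize (i : ℕ) = a at *
  generalize (j : ℕ) = b at *
  simp only [hM] at hi hj ⊢
  have inc : ∀ a b : ℕ, a < 2 * M → b < 2 * M → (if a = (b + 1) % (2 * M) then (1 : ℂ) else 0)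
      = (if b + 1 = a then 1 else 0) + if a = 0 ∧ b + 1 = 2 * M then 1 else 0 := by
    intro a b ha hb
    by_cases hbM : b + 1 = 2 * M
    · rw [hbM, Nat.mod_self, if_neg (show ¬ 2 * M = a by omega), zero_add]
      simp
    · rw [Nat.mod_eq_of_lt (by omega), if_neg (show ¬ (a = 0 ∧ b + 1 = 2 * M) from fun h => hbM h.2),
        add_zero]
      simp only [eq_comm]
  have lap : (if a = b then (-2 : ℂ) else if a + 1 = b ∨ b + 1 = a then 1 else 0)
      = -2 * (if a = b then 1 else 0) + (if a + 1 = b then 1 else 0) + if b + 1 = a then 1 else 0 := by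
    split_ifs <;> first | omega | norm_num
  have dif : (if a + 1 = b then (1 : ℂ) else if b + 1 = a then -1 else 0)
      = (if a + 1 = b then 1 else 0) - if b + 1 = a then 1 else 0 := by
    split_ifs <;> first | omega | norm_num
  have anti : (if a + b + 1 = 2 * M then (if a = 0 ∨ b = 0 then (1 : ℂ) else -1) else 0)
      = 2 * (if a = 0 ∧ b + 1 = 2 * M then 1 else 0) + 2 * (if b = 0 ∧ a + 1 = 2 * M then 1 else 0)
        - if a + b + 1 = 2 * M then 1 else 0 := by
    split_ifs <;> first | omega | norm_num
  have z1 : (if a % 2 = 0 then (1 : ℂ) else -1) * (if a = 0 ∧ b + 1 = 2 * M then 1 else 0)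
      = if a = 0 ∧ b + 1 = 2 * M then 1 else 0 := by
    split_ifs <;> first | omega | norm_num
  have z2 : (if a % 2 = 0 then (1 : ℂ) else -1) * (if b = 0 ∧ a + 1 = 2 * M then 1 else 0)
      = -if b = 0 ∧ a + 1 = 2 * M then 1 else 0 := by
    split_ifs <;> first | omega | norm_num
  have st : star (if b = (a + 1) % (2 * M) then (1 : ℂ) else 0)
      = if b = (a + 1) % (2 * M) then (1 : ℂ) else 0 := by
    split_ifs <;> simp
  rw [st, inc a b hi hj, inc b a hj hi, lap, dif, anti]
  push_cast
  linear_combination (-(h : ℂ) * p / 2) * (z1 + z2)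

/-! ### Circuits for the terms -/

/-- The data wires, least significant bit first. -/
def dataWires (n : ℕ) : List (Fin (n + 1)) := (List.finRange n).reverse.map Fin.castSucc

theorem length_dataWires (n : ℕ) : (dataWires n).length = n := by simp [dataWires]

theorem mem_dataWires {n : ℕ} {w : Fin (n + 1)} : w ∈ dataWires n ↔ w ≠ Fin.last n := by
  simp only [dataWires, List.mem_map, List.mem_reverse, List.mem_finRange, true_and]
  exact Fin.exists_castSucc_eq

theorem nodup_dataWires (n : ℕ) : (dataWires n ++ [Fin.last n]).Nodup := by
  rw [List.nodup_append]
  refine ⟨?_, by simp, ?_⟩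
  · exact ((List.nodup_reverse.2 (List.nodup_finRange n))).map (Fin.castSucc_injective n)
  · intro a ha b hb
    rw [List.mem_singleton.1 hb]
    exact mem_dataWires.1 ha

theorem val_dataWires {n : ℕ} (x : BasisState (n + 1)) :
    val x (dataWires n) = ((binIdx n (x ∘ Fin.castSucc) : ℕ) : ℤ) :=
  val_reverse_finRange Fin.castSucc x

/-- The data wires hold a number in [0, 2^n), so its residue determines them; `Adds` fixes this
residue and the ancilla. -/
theorem eq_iff_of_adds {n : ℕ} {v : BasisState (n + 1) → ℤ}
    {f : BasisState (n + 1) → BasisState (n + 1)} (hf : Adds (dataWires n) v f)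
    (y x : BasisState (n + 1)) :
    y = f x ↔ ((binIdx n (y ∘ Fin.castSucc) : ℕ) : ℤ)
      ≡ (binIdx n (x ∘ Fin.castSucc) : ℕ) + v x [ZMOD 2 ^ n] ∧ y (Fin.last n) = x (Fin.last n) := by
  obtain ⟨h1, h2⟩ := hf x
  rw [val_dataWires, val_dataWires, length_dataWires] at h2
  have h3 := h1 (Fin.last n) fun h => mem_dataWires.1 h rfl
  constructor
  · rintro rfl
    exact ⟨h2, h3⟩
  · rintro ⟨h4, h5⟩
    have h6 := h4.trans h2.symm
    have h7 : binIdx n (y ∘ Fin.castSucc) = binIdx n (f x ∘ Fin.castSucc) := by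
      have l1 := (binIdx n (y ∘ Fin.castSucc)).isLt
      have l2 := (binIdx n (f x ∘ Fin.castSucc)).isLt
      refine Fin.ext ?_
      zify at l1 l2 ⊢
      rwa [Int.ModEq, Int.emod_eq_of_lt (by positivity) l1, Int.emod_eq_of_lt (by positivity) l2]
        at h6
    rw [funext_iff, Fin.forall_fin_succ']
    exact ⟨congrFun ((binIdx n).injective h7), h5.trans h3.symm⟩

theorem modEq_succ_iff {N a b : ℕ} (ha : a < N) :
    a = (b + 1) % N ↔ (a : ℤ) ≡ b + 1 [ZMOD N] := by
  rw [show (b : ℤ) + 1 = ((b + 1 : ℕ) : ℤ) by push_cast; rfl, Int.natCast_modEq_iff, Nat.ModEq,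
    Nat.mod_eq_of_lt ha]

theorem attains_increment (n : ℕ) :
    Attains (withAncilla (increment n)) 0 0 (80 * n + 30) := by
  obtain ⟨f, hf, hm⟩ := exists_adds_one (nodup_dataWires n)
  rw [length_dataWires] at hm
  convert hm.attains using 1
  refine ext_binIdx fun y x => ?_
  rw [withAncilla_apply, ofBasis_apply, signedMap_apply, increment, Matrix.of_apply,
    if_congr (modEq_succ_iff (Fin.isLt _)) rfl rfl]
  push_cast
  simp only [eq_iff_of_adds hf]
  split_ifs <;> simp_all

theorem attains_increment_conjTranspose (n : ℕ) :
    Attains (withAncilla (increment n)ᴴ) 0 0 (82 * n + 30) := by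
  obtain ⟨f₀, hf₀, hm₀⟩ := exists_adds_one (nodup_dataWires n)
  obtain ⟨f, hf, hm⟩ := exists_adds_neg (List.nodup_append.1 (nodup_dataWires n)).1
    (fun _ _ _ => rfl) hf₀ hm₀
  rw [length_dataWires] at hm
  convert (hm.mono (show _ ≤ 82 * n + 30 by omega)).attains using 1
  refine ext_binIdx fun y x => ?_
  rw [withAncilla_apply, ofBasis_apply, signedMap_apply, Matrix.conjTranspose_apply, increment,
    Matrix.of_apply, if_congr (modEq_succ_iff (Fin.isLt _)) rfl rfl]
  push_cast
  simp only [eq_iff_of_adds hf]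
  have h : ∀ a b N : ℤ, a ≡ b + 1 [ZMOD N] ↔ b ≡ a + -1 [ZMOD N] := by
    intro a b N
    rw [Int.modEq_iff_dvd, Int.modEq_iff_dvd, ← dvd_neg]
    ring_nf
  simp only [h]
  split_ifs <;> simp_all

theorem flipAll_dataWires_castSucc {n : ℕ} (x : BasisState (n + 1)) :
    flipAll (dataWires n) (fun _ => 1) x ∘ Fin.castSucc = compl (x ∘ Fin.castSucc) := by
  funext q
  exact flipAll_of_mem (mem_dataWires.2 (Fin.castSucc_ne_last q)) _ _

theorem flipAll_dataWires_last {n : ℕ} (b : BasisState (n + 1) → Fin 2) (x : BasisState (n + 1)) :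
    flipAll (dataWires n) b x (Fin.last n) = x (Fin.last n) :=
  flipAll_of_notMem (fun h => mem_dataWires.1 h rfl) _ _

theorem realizes_flipAll_dataWires (n : ℕ) :
    Realizes (flipAll (dataWires n) fun _ => 1) n := by
  have := Realizes.flipAll_one (List.nodup_append.1 (nodup_dataWires n)).1
  rwa [length_dataWires] at this

theorem attains_tensorX (n : ℕ) : Attains (withAncilla (tensorX n)) 0 0 n := by
  rw [tensorX_eq, withAncilla_ofBasis (ψ := fun _ => 1) (fun _ => rfl)
    flipAll_dataWires_castSucc (flipAll_dataWires_last _)]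
  exact (realizes_flipAll_dataWires n).attains

theorem withAncilla_mul {n : ℕ} (U V : Op n) :
    withAncilla (U * V) = withAncilla U * withAncilla V := by
  simp only [withAncilla, Matrix.reindex_apply, Matrix.submatrix_mul_equiv,
    ← Matrix.mul_kronecker_mul, mul_one]

theorem withAncilla_one (n : ℕ) : withAncilla (1 : Op n) = 1 := by
  rw [withAncilla, Matrix.one_kronecker_one, Matrix.reindex_apply, Matrix.submatrix_one_equiv]

theorem attains_lastZ (m : ℕ) : Attains (withAncilla (lastZ (m + 1))) 1 0 0 := by
  rw [lastZ_eq, withAncilla_ofBasis (ψ := fun x => sgn (x (Fin.last m).castSucc)) (g := id)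
    (fun _ => rfl) (fun _ => rfl) (fun _ => rfl)]
  exact attains_pauliZ _

/-! ### The two anti-diagonal terms with signs. -/

theorem antiDiagMinus_one : antiDiagMinus 1 = tensorX 1 := by
  rw [antiDiagMinus_eq, tensorX_eq]
  congr 2
  funext x
  have : constBit x = 1 := if_pos fun q r => by rw [show q = r from Fin.ext (by omega)]
  rw [this]
  simp [sgn]

/-- The data wires except the last one. -/
def initWires (m : ℕ) : List (Fin (m + 3)) :=
  (List.finRange (m + 1)).map fun q => q.castSucc.castSucc

theorem mem_initWires {m : ℕ} {w : Fin (m + 3)} : w ∈ initWires m ↔ (w : ℕ) < m + 1 := by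
  simp only [initWires, List.mem_map, List.mem_finRange, true_and]
  constructor
  · rintro ⟨q, rfl⟩
    exact q.isLt
  · exact fun h => ⟨⟨w, h⟩, rfl⟩

theorem nodup_initWires (m : ℕ) : (initWires m).Nodup :=
  (List.nodup_finRange _).map
    ((Fin.castSucc_injective (m + 2)).comp (Fin.castSucc_injective (m + 1)))

/-- Compare all data wires with the last one. -/
def compareLast (m : ℕ) : BasisState (m + 3) → BasisState (m + 3) :=
  flipAll (initWires m) fun s => s (Fin.last (m + 1)).castSucc + 1

theorem last_notMem_initWires (m : ℕ) : (Fin.last (m + 1)).castSucc ∉ initWires m := by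
  rw [mem_initWires]
  simp

theorem compareLast_last {m : ℕ} (x : BasisState (m + 3)) :
    compareLast m x (Fin.last (m + 1)).castSucc = x (Fin.last (m + 1)).castSucc :=
  flipAll_of_notMem (last_notMem_initWires m) _ _

theorem compareLast_compareLast {m : ℕ} (x : BasisState (m + 3)) : compareLast m (compareLast m x) = x := by
  funext w
  by_cases hw : w ∈ initWires m
  · rw [compareLast, flipAll_of_mem hw]
    have := compareLast_last x
    rw [compareLast] at this
    rw [this, flipAll_of_mem hw, add_bit_add_bit]
  · rw [compareLast, flipAll_of_notMem hw, flipAll_of_notMem hw]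

theorem realizes_compareLast (m : ℕ) : Realizes (compareLast m) (2 * (m + 1)) := by
  have hl : (initWires m).length = m + 1 := by simp [initWires]
  have h1 := Realizes.flipAll_one (nodup_initWires m)
  have h2 := Realizes.flipAll_wire (nodup_initWires m) (last_notMem_initWires m)
  rw [hl] at h1 h2
  convert (h1.comp h2).mono (show _ ≤ 2 * (m + 1) by omega) using 1
  funext x w
  by_cases hw : w ∈ initWires m
  · rw [compareLast, Function.comp_apply, flipAll_of_mem hw, flipAll_of_mem hw, flipAll_of_mem hw]
    exact (add_assoc _ _ _).symm
  · rw [compareLast, Function.comp_apply, flipAll_of_notMem hw, flipAll_of_notMem hw,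
      flipAll_of_notMem hw]

theorem allOnes_compareLast {m : ℕ} (x : BasisState (m + 3)) :
    allOnes (initWires m) (compareLast m x) = constBit (x ∘ Fin.castSucc) := by
  unfold allOnes constBit
  refine if_congr ?_ rfl rfl
  have hb : ∀ a b : Fin 2, a + (b + 1) = 1 ↔ a = b := by decide
  have h1 : (∀ w ∈ initWires m, compareLast m x w = 1) ↔
      ∀ w ∈ initWires m, x w = x (Fin.last (m + 1)).castSucc :=
    forall₂_congr fun w hw => by rw [compareLast, flipAll_of_mem hw, hb]
  rw [h1]
  constructor
  · intro h
    have : ∀ q : Fin (m + 2), x q.castSucc = x (Fin.last (m + 1)).castSucc := by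
      intro q
      by_cases hq : (q : ℕ) < m + 1
      · exact h _ (mem_initWires.2 (by simpa using hq))
      · rw [show q = Fin.last (m + 1) from Fin.ext (by simp; omega)]
    intro q r
    rw [Function.comp_apply, Function.comp_apply, this q, this r]
  · intro h w hw
    have hw' := mem_initWires.1 hw
    exact h ⟨w, by omega⟩ (Fin.last (m + 1))

/-- Conjugating a diagonal gate by `compareLast`, then negating all data wires. -/
theorem attains_of_phase {m z h c : ℕ} {φ : BasisState (m + 2) → ℂ} {ψ : BasisState (m + 3) → ℂ}
    (hφ : ∀ x, ψ (compareLast m x) = φ (x ∘ Fin.castSucc))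
    (H : Attains (ofBasis (signedMap ψ id)) z h c) :
    Attains (withAncilla (ofBasis (signedMap φ compl))) z h (c + 5 * (m + 2)) := by
  have h1 := (realizes_compareLast m).attains
  have h2 := (realizes_flipAll_dataWires (m + 2)).attains
  have h3 := attains_signedMap_comp h2
    (attains_signedMap_comp h1 (attains_signedMap_comp H h1))
  rw [withAncilla_ofBasis (ψ := fun x => φ (x ∘ Fin.castSucc)) (fun _ => rfl)
    flipAll_dataWires_castSucc (flipAll_dataWires_last _)]
  convert h3.mono (by omega : _ ≤ z) (by omega : _ ≤ h) (by omega : _ ≤ c + 5 * (m + 2)) using 3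
  · funext x
    simp only [mul_one, one_mul, hφ]
  · funext x
    simp only [Function.comp_apply, id, compareLast_compareLast]

/-- The data wires except the first and the last one. -/
def middleWires (m : ℕ) : List (Fin (m + 3)) :=
  (List.finRange m).map fun q => q.succ.castSucc.castSucc

theorem initWires_eq (m : ℕ) : initWires m = 0 :: middleWires m := by
  rw [initWires, List.finRange_succ, List.map_cons, List.map_map]
  rfl

theorem zero_notMem_middleWires (m : ℕ) : (0 : Fin (m + 3)) ∉ middleWires m := by
  have := nodup_initWires m
  rw [initWires_eq, List.nodup_cons] at this
  exact this.1

theorem realizes_allOnes_middleWires (m : ℕ) :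
    Realizes (toggle 0 (allOnes (middleWires m))) (8 * m + 12) := by
  have hn : (middleWires m ++ [0, Fin.last (m + 2)]).Nodup := by
    have h1 := nodup_initWires m
    have h2 : Fin.last (m + 2) ∉ initWires m := by rw [mem_initWires]; simp
    rw [initWires_eq, List.nodup_cons] at h1
    rw [initWires_eq, List.mem_cons, not_or] at h2
    rw [List.nodup_append]
    refine ⟨h1.2, by simp, ?_⟩
    intro a ha b hb
    rcases List.mem_pair.1 hb with rfl | rfl
    · exact ne_of_mem_of_not_mem ha h1.1
    · exact ne_of_mem_of_not_mem ha h2.2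
  have hl : (middleWires m).length = m := by simp [middleWires]
  simpa [hl] using Realizes.allOnes hn

theorem allOnes_middleWires_congr {m : ℕ} {x x' : BasisState (m + 3)}
    (h : ∀ w, w ≠ 0 → x w = x' w) : allOnes (middleWires m) x = allOnes (middleWires m) x' :=
  allOnes_congr fun w hw => h w (ne_of_mem_of_not_mem hw (zero_notMem_middleWires m))

theorem attains_antiDiagMinus (m : ℕ) :
    Attains (withAncilla (antiDiagMinus (m + 2))) 1 2 (13 * m + 30) := by
  -- After the comparison, let a be the first wire and b the conjunction of the middle ones. The
  -- exponent is 1 + ab = (b + 1)a + (a + 1) modulo 2: a phase from two Hadamards, and a single `Z`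
  -- conjugated by `X`.
  have h1 := (Realizes.not (0 : Fin (m + 3))).comp (realizes_allOnes_middleWires m)
  have h2 : toggle (0 : Fin (m + 3)) (fun _ => 1) ∘ toggle 0 (allOnes (middleWires m))
      = toggle 0 fun x => allOnes (middleWires m) x + 1 := by
    funext x w
    by_cases hw : w = 0
    · subst hw
      rw [Function.comp_apply, toggle_same, toggle_same, toggle_same, add_assoc]
    · rw [Function.comp_apply, toggle_of_ne hw, toggle_of_ne hw, toggle_of_ne hw]
  rw [h2] at h1
  have h3 := h1.attains_phase fun x x' h => by rw [allOnes_middleWires_congr h]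
  have hX := (Realizes.not (0 : Fin (m + 3))).attains
  have h4 := attains_signedMap_comp h3
    (attains_signedMap_comp hX (attains_signedMap_comp (attains_pauliZ 0) hX))
  rw [antiDiagMinus_eq]
  have hid : id ∘ toggle (0 : Fin (m + 3)) (fun _ => 1) ∘ id ∘ toggle 0 (fun _ => 1) = id := by
    funext x w
    by_cases hw : w = 0
    · subst hw
      simp only [Function.comp_apply, id, toggle_same, add_bit_add_bit]
    · simp only [Function.comp_apply, id, toggle_of_ne hw]
  rw [hid] at h4
  refine (attains_of_phase ?_ h4).mono le_rfl le_rfl (by omega)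
  intro x
  rw [← allOnes_compareLast, initWires_eq, allOnes_cons]
  simp only [Function.comp_apply, id, toggle_same, add_bit_add_bit, one_mul, mul_one]
  have ht : ∀ y : BasisState (m + 3), toggle 0 (fun _ => 1) (toggle 0 (fun _ => 1) y) = y :=
    fun y => congrFun hid y
  rw [ht, ← sgn_add]
  congr 1
  generalize compareLast m x 0 = a, allOnes (middleWires m) (compareLast m x) = b
  revert a b; decide

theorem attains_lastZ_mul_antiDiagMinus (m : ℕ) :
    Attains (withAncilla (lastZ (m + 2) * antiDiagMinus (m + 2))) 1 2 (13 * m + 30) := by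
  -- `lastZ` acts after the negation of all bits, so it contributes the exponent c + 1 for the last
  -- data bit c. Its 1 cancels the one in 1 + ab, leaving ab + c, hence a plain `Z` on that wire.
  have h3 := (realizes_allOnes_middleWires m).attains_phase fun x x' h =>
    allOnes_middleWires_congr h
  have h4 := attains_signedMap_comp (attains_pauliZ (Fin.last (m + 1)).castSucc) h3
  rw [antiDiagMinus_eq, lastZ_eq, ← ofBasis_mul, signedMap_mul, Function.id_comp]
  rw [Function.id_comp] at h4
  refine (attains_of_phase ?_ h4).mono le_rfl le_rfl (by omega)
  intro x
  rw [← allOnes_compareLast, initWires_eq, allOnes_cons, id, compareLast_last, ← sgn_add, ← sgn_add, compl,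
    Function.comp_apply]
  congr 1
  generalize compareLast m x 0 = a, allOnes (middleWires m) (compareLast m x) = b,
    x (Fin.last (m + 1)).castSucc = c
  revert a b c; decide

theorem attains_lcuTerm (n : ℕ) (hn : 1 ≤ n) (l : Fin 7) :
    Attains (withAncilla (lcuTerm n l)) 1 2 (112 * n) := by
  obtain ⟨m, rfl⟩ : ∃ m, n = m + 1 := ⟨n - 1, by omega⟩
  have hX := attains_tensorX (m + 1)
  have hZ := attains_lastZ m
  have hZX := hZ.mul hX
  rw [← withAncilla_mul] at hZX
  have hA : Attains (withAncilla (antiDiagMinus (m + 1))) 1 2 (112 * (m + 1)) ∧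
      Attains (withAncilla (lastZ (m + 1) * antiDiagMinus (m + 1))) 1 2 (112 * (m + 1)) := by
    -- On a single qubit there is nothing to compare: both anti-diagonal entries are corners.
    cases m with
    | zero =>
      rw [zero_add, antiDiagMinus_one]
      exact ⟨hX.mono (by omega) (by omega) (by omega), hZX.mono (by omega) (by omega) (by omega)⟩
    | succ m =>
      exact ⟨(attains_antiDiagMinus m).mono le_rfl le_rfl (by omega),
        (attains_lastZ_mul_antiDiagMinus m).mono le_rfl le_rfl (by omega)⟩
  fin_cases l
  · change Attains (withAncilla 1) _ _ _
    rw [withAncilla_one, ← ofBasis_one, ← signedMap_one]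
    exact Realizes.id.attains.mono (by omega) (by omega) (by omega)
  · exact (attains_increment (m + 1)).mono (by omega) (by omega) (by omega)
  · exact (attains_increment_conjTranspose (m + 1)).mono (by omega) (by omega) (by omega)
  · exact hX.mono (by omega) (by omega) (by omega)
  · exact hA.1
  · exact hZX.mono (by omega) (by omega) (by omega)
  · exact hA.2

end LCU

theorem theorem4 :
    ∃ K : ℕ, ∀ n : ℕ, 1 ≤ n →
      (∀ p : ℝ,
        LCU.normLaplacian n + (p * LCU.meshSize n ^ 2) • LCU.centralDiff n
          = ∑ l : Fin 7, LCU.lcuCoeff n p l • LCU.lcuTerm n l) ∧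
      ∀ l : Fin 7,
        LCU.lcuTerm n l ∈ Matrix.unitaryGroup (Fin (2 ^ n)) ℂ ∧
        ∃ Q : LCU.Circuit (n + 1),
          LCU.Implements Q (LCU.lcuTerm n l) ∧
          Q.countP LCU.Gate.isZ ≤ 1 ∧
          Q.countP LCU.Gate.isH ≤ 2 ∧
          Q.countP LCU.Gate.isClassical ≤ K * n := by
  -- The constant comes from the largest count, that of the adjoint increment: 82n + 30 ≤ 112n for n
  -- ≥ 1.
  refine ⟨112, fun n hn => ⟨LCU.decomposition n hn, fun l => ?_⟩⟩
  obtain ⟨Q, hQ, hz, hh, hc⟩ := LCU.attains_lcuTerm n hn l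
  have hQ' : LCU.Implements Q (LCU.lcuTerm n l) := hQ
  exact ⟨hQ'.mem_unitaryGroup, Q, hQ', hz, hh, hc⟩
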